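/- **Conventions.** In a forcing notion the larger condition is the stronger one; $p,q$ are compatible if some condition is above both. $\mathbf H$ is a function on $\omega$ such that every $\mathbf H(n)$ is a countable set with at least two elements. For finite sequences, $\trianglelefteq$ means "initial segment", $\vartriangleleft$ "proper initial segment", and ${\rm lh}$ is the length. $\forall^\infty n$ means "for all but finitely many $n$". **Functions.** $h:\omega\times\omega\to\omega$ is *regressive* if for all $m$: $1\le h(m,k)<k$ for all $k>1$, and $h(m,k)\le h(m,\ell)$ for $k<\ell$. A family $\mathcal F\subseteq\omega^\omega$ is *$h$-closed* if $(\forall f\in\mathcal F)(\exists f^*\in\mathcal F)(\forall^\infty n)(f^*(n)\le h(n,f(n)))$, and *$\ge^*$-directed* if $(\forall f_0,f_1\in\mathcal F)(\exists f^*\in\mathcal F)(\forall^\infty n)(f^*(n)\le\min\{f_0(n),f_1(n)\})$. **Creating pairs.** A *creature* is a triple $t=({\rm nor}[t],{\bf val}[t],{\bf dis}[t])$ with ${\rm nor}[t]\in[0,\infty)$, ${\bf dis}[t]$ any object, and, for some $m^t_{\rm dn}<m^t_{\rm up}<\omega$, $\emptyset\ne{\bf val}[t]\subseteq\{\langle u,v\rangle\in\prod_{i<m^t_{\rm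 dn}}\mathbf H(i)\times\prod_{i<m^t_{\rm up}}\mathbf H(i):u\vartriangleleft v\}$. A *creating pair* $(K,\Sigma)$ is a set $K$ of creatures with an operation $\Sigma$ from finite subsets of $K$ to subsets of $K$ such that (a) if $\Sigma(\mathcal S)\neq\emptyset$ then $\mathcal S=\{t_0,\dots,t_k\}$ with $m^{t_i}_{\rm up}=m^{t_{i+1}}_{\rm dn}$ for $i<k$ (this enumeration is meant whenever we write $\Sigma(t_0,\dots,t_k)$); (b) $s\in\Sigma(t_0,\dots,t_k)$ implies $m^s_{\rm dn}=m^{t_0}_{\rm dn}$, $m^s_{\rm up}=m^{t_k}_{\rm up}$; (c) $t\in\Sigma(t)$ for $t\in K$, and $\Sigma(\emptyset)=\emptyset$; (d) if $s_i\in\Sigma(\mathcal S_i)$ for $i\le n$, then $\Sigma(s_0,\dots,s_n)\subseteq\Sigma(\mathcal S_0\cup\dots\cup\mathcal S_n)$; (e) if $s\in\Sigma(t_0,\dots,t_k)$ then ${\rm dom}({\bf val}[s])={\rm dom}({\bf val}[t_0])$ and $\langle v{\restriction}m^{t_i}_{\rm dn},v{\restriction}m^{t_i}_{\rm up}\rangle\in{\bf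 val}[t_i]$ for all $\langle u,v\rangle\in{\bf val}[s]$, $i\le k$. It is *local* if $m^t_{\rm up}=m^t_{\rm dn}+1$ for all $t\in K$, and *forgetful* if $\langle u,v\rangle\in{\bf val}[t]$, $t\in K$, $w\in\prod_{i<m^t_{\rm dn}}\mathbf H(i)$ imply $\langle w,w^\frown v{\restriction}[m^t_{\rm dn},m^t_{\rm up})\rangle\in{\bf val}[t]$. It is *$h$-linked* if for all natural $k>1$ and $t_0,t_1\in K$ with ${\rm nor}[t_0],{\rm nor}[t_1]\ge k$, $m^{t_0}_{\rm dn}=m^{t_1}_{\rm dn}$, $m^{t_0}_{\rm up}=m^{t_1}_{\rm up}$ there is $s\in\Sigma(t_0)\cap\Sigma(t_1)$ with ${\rm nor}[s]\ge h(m^{t_0}_{\rm dn},k)$. It is *of BCB type* if it is local, forgetful, and for every $i$ and every sequence $\langle s_n:n<\omega\rangle$ in $K$ with $m^{s_n}_{\rm dn}=i$, ${\rm nor}[s_n]\ge2$, there are a finite $E\subseteq\mathbf H(i)$ and $n_0<n_1<\dots$ such that for every $a\in\mathbf H(i)\setminus E$, for all but finitely many $k$, $\langle u,u^\frown\langle a\rangle\rangle\in{\bf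 val}[s_{n_k}]$ for all $u\in{\rm dom}({\bf val}[s_{n_k}])$. **The forcing $\mathbb Q^*_{\mathcal F}(K,\Sigma)$.** Let ${\rm pos}(w,t_0,\dots,t_n)$ be the set of $v\in\prod_{j<m^{t_n}_{\rm up}}\mathbf H(j)$ with $w\vartriangleleft v$ and $\langle v{\restriction}m^{t_i}_{\rm dn},v{\restriction}m^{t_i}_{\rm up}\rangle\in{\bf val}[t_i]$ for all $i\le n$. $\mathbb Q^*_\emptyset(K,\Sigma)$ consists of the sequences $p=(w,t_0,t_1,\dots)$ with $t_i\in K$, $m^{t_i}_{\rm up}=m^{t_{i+1}}_{\rm dn}$, $w\in{\rm dom}({\bf val}[t_0])$ and ${\rm pos}(w,t_0,\dots,t_i)\subseteq{\rm dom}({\bf val}[t_{i+1}])$ for all $i$. Conditions of $\mathbb Q^*_{\mathcal F}(K,\Sigma)$ are those $p\in\mathbb Q^*_\emptyset(K,\Sigma)$ for which $(\exists f\in\mathcal F)(\forall^\infty i)({\rm nor}[t_i]\ge f(m^{t_i}_{\rm dn}))$. We put $p\le q$ if $q$ is obtained from $p$ by finitely many operations (inside $\mathbb Q^*_\emptyset(K,\Sigma)$)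 of the forms: replace $(w,t_0,t_1,\dots)$ by $(w^*,t_n,t_{n+1},\dots)$ with $w^*\in{\rm pos}(w,t_0,\dots,t_{n-1})$; replace it by $(w,t_0^*,t_1^*,\dots)$ where $t^*_i\in\Sigma(t_{n_i},\dots,t_{n_{i+1}-1})$ for some $0=n_0<n_1<\cdots$. **Tree-creating pairs.** A *(local) tree-creature* is a triple $t=({\rm nor}[t],{\bf val}[t],{\bf dis}[t])$ as above, but with $\emptyset\ne{\bf val}[t]\subseteq\{\langle\eta,\nu\rangle:\eta\vartriangleleft\nu\in\prod_{i\le n}\mathbf H(i)\}$ for one $\eta=\eta_t\in\prod_{i<n}\mathbf H(i)$, $n<\omega$; ${\rm pos}(t)={\rm rng}({\bf val}[t])$. A *tree-creating pair* is a set $K$ of tree-creatures with $\Sigma:K\to\mathcal P(K)$ such that $s\in\Sigma(t)$ implies $\eta_s=\eta_t$, ${\bf val}[s]\subseteq{\bf val}[t]$ and $\Sigma(s)\subseteq\Sigma(t)$. It is *$h$-linked* if for all natural $k>1$ and $t_0,t_1\in K$ with $\eta_{t_0}=\eta_{t_1}=\eta$ and norms $\ge k$ there is $s\in\Sigma(t_0)\cap\Sigma(t_1)$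 with ${\rm nor}[s]\ge h({\rm lh}(\eta),k)$. It is *of BCB$^{\rm tree}$ type* if for every $\eta$ and $\langle s_n:n<\omega\rangle$ in $K$ with $\eta_{s_n}=\eta$, ${\rm nor}[s_n]\ge2$, there are a finite $E\subseteq\mathbf H({\rm lh}(\eta))$ and $n_0<n_1<\dots$ with $(\forall a\in\mathbf H({\rm lh}(\eta))\setminus E)(\forall^\infty k)(\eta^\frown\langle a\rangle\in{\rm pos}(s_{n_k}))$. Conditions of $\mathbb Q^{\rm tree}_{\mathcal F}(K,\Sigma)$ are systems $p=\langle t_\eta:\eta\in T\rangle$, where $T\subseteq\bigcup_n\prod_{i<n}\mathbf H(i)$ is a tree (it has a root that is an initial segment of all its elements, and contains all $\nu$ with ${\rm root}\trianglelefteq\nu\trianglelefteq\eta\in T$) without maximal nodes, $t_\eta\in K$, $\eta_{t_\eta}=\eta$, ${\rm pos}(t_\eta)$ is the set of immediate successors of $\eta$ in $T$, and $(\exists f\in\mathcal F)(\exists N)(\forall\eta\in T)({\rm lh}(\eta)\ge N\Rightarrow{\rm nor}[t_\eta]\ge f({\rm lh}(\eta)))$. Here $\langle t^1_\eta:\eta\in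 T^1\rangle\le\langle t^2_\eta:\eta\in T^2\rangle$ iff $T^2\subseteq T^1$ and $t^2_\eta\in\Sigma(t^1_\eta)$ for all $\eta\in T^2$. A local creating pair or tree-creating pair is *Cohen-producing* if for each $n$ there is $A_n\subseteq\mathbf H(n)$ such that whenever $t\in K$, ${\rm nor}[t]>1$, $u\in{\rm dom}({\bf val}[t])$, ${\rm lh}(u)=n$, there are $v_0,v_1$ with $\langle u,v_0\rangle,\langle u,v_1\rangle\in{\bf val}[t]$, $v_1(n)\in A_n$, $v_0(n)\notin A_n$. A forcing notion $\mathbb P$ is *nice* if it is ccc and there is a partition $\langle P_m:m<\omega\rangle$ of $\mathbb P$ such that for every maximal antichain $\langle p_n:n<\omega\rangle$ and every $m$ there is $N<\omega$ such that every $p\in P_m$ is compatible with some $p_n$, $n<N$. It *preserves unbounded families* if every family $\mathcal B\subseteq\omega^\omega$ that is not bounded in the order $\le^*$ of eventual domination is forced to remain unbounded. It *adds a Cohen real* if there is a name for an element of $2^\omega$ that is forced to be Cohen generic over the ground model. **Theorem.** Let $h:\omega\times\omega\to\omega$ be regressive and let $\mathcal F\subseteq(\omega\setminus2)^\omega$ be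 countable, $h$-closed and $\ge^*$-directed. 1. If $(K,\Sigma)$ is a local, Cohen-producing, $h$-linked creating pair, then $\mathbb Q^*_{\mathcal F}(K,\Sigma)$ adds a Cohen real. If $(K,\Sigma)$ is a Cohen-producing, $h$-linked (local) tree-creating pair, then $\mathbb Q^{\rm tree}_{\mathcal F}(K,\Sigma)$ adds a Cohen real. 2. If $(K,\Sigma)$ is an $h$-linked tree-creating pair of BCB$^{\rm tree}$ type, then $\mathbb Q^{\rm tree}_{\mathcal F}(K,\Sigma)$ is nice, and it preserves unbounded families. 3. If $(K,\Sigma)$ is an $h$-linked creating pair of BCB type, then $\mathbb Q^*_{\mathcal F}(K,\Sigma)$ is nice, and it preserves unbounded families. -/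

import Mathlib

open Filter
open scoped NNReal

universe u v

/-! ## Forcing notions

A forcing notion is a type of conditions with a relation `le`; a *larger* condition is *stronger*. -/

namespace Forcing

variable {P : Type u}

/-- `p` and `q` have a common stronger condition. -/
def Compat (le : P → P → Prop) (p q : P) : Prop := ∃ r, le p r ∧ le q r

/-- An antichain: distinct elements are incompatible. -/
def IsAntichain (le : P → P → Prop) (A : Set P) : Prop :=
  ∀ p ∈ A, ∀ q ∈ A, p ≠ q → ¬ Compat le p q

/-- A maximal antichain: an antichain such that every condition is compatible with one of
its elements. -/
def IsMaximalAntichain (le : P → P → Prop) (A : Set P) : Prop :=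
  IsAntichain le A ∧ ∀ q, ∃ p ∈ A, Compat le q p

/-- The countable chain condition. -/
def CCC (le : P → P → Prop) : Prop := ∀ A : Set P, IsAntichain le A → A.Countable

/-- Niceness. The partition of `P` into countably many pieces (some of them possibly empty) is
given by the function `c` that tells the index of the piece. -/
def Nice (le : P → P → Prop) : Prop :=
  CCC le ∧ ∃ c : P → ℕ, ∀ p : ℕ → P, IsMaximalAntichain le (Set.range p) →
    ∀ m : ℕ, ∃ N : ℕ, ∀ q, c q = m → ∃ n < N, Compat le q (p n)

/-- A (nice) name for a function from `ℕ` to `α`: the set `val n a` consists of conditions which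
force the value at `n` to be `a`; for every `n` these sets are together predense, and
different values are given to incompatible conditions only. -/
structure FunName (le : P → P → Prop) (α : Type v) where
  val : ℕ → α → Set P
  predense : ∀ n p, ∃ a, ∃ q ∈ val n a, Compat le p q
  unique : ∀ n a b, ∀ p ∈ val n a, ∀ q ∈ val n b, Compat le p q → a = b

/-- `p` forces that the value of the named function at `n` belongs to `S`. -/
def FunName.Forces {le : P → P → Prop} {α : Type v} (g : FunName le α) (p : P) (n : ℕ)
    (S : Set α) : Prop :=
  ∀ q, le p q → ∃ a ∈ S, ∃ r ∈ g.val n a, Compat le q r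

/-- There is a name for an element of the Cantor space which is forced to have an initial segment
in every (ground model) dense set of finite binary sequences. -/
def AddsCohenReal (le : P → P → Prop) : Prop :=
  ∃ c : FunName le Bool, ∀ D : Set (List Bool), (∀ s, ∃ t ∈ D, s <+: t) →
    ∀ p, ∃ q, le p q ∧ ∃ s ∈ D, ∀ (i : ℕ) (hi : i < s.length), c.Forces q i {s[i]}

/-- A family of functions that is not bounded in the order of eventual domination. -/
def UnboundedFamily (B : Set (ℕ → ℕ)) : Prop :=
  ¬ ∃ g : ℕ → ℕ, ∀ f ∈ B, ∀ᶠ n in atTop, f n ≤ g n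

/-- Every (ground model) unbounded family is forced to remain unbounded: for every name `g` of an
element of the Baire space, it is forced that for some `f ∈ B` there are infinitely many `n` with
`g n < f n`. -/
def PreservesUnbounded (le : P → P → Prop) : Prop :=
  ∀ B : Set (ℕ → ℕ), UnboundedFamily B → ∀ g : FunName le ℕ, ∀ p, ∃ q, le p q ∧ ∃ f ∈ B,
    ∀ (m : ℕ) (r : P), le q r → ∃ r', le r r' ∧ ∃ n > m, g.Forces r' n {k | k < f n}

end Forcing

/-! ## Families of functions -/

def Regressive (h : ℕ → ℕ → ℕ) : Prop :=
  ∀ m, (∀ k > 1, 1 ≤ h m k ∧ h m k < k) ∧ ∀ k l, k < l → h m k ≤ h m l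

def HClosed (h : ℕ → ℕ → ℕ) (F : Set (ℕ → ℕ)) : Prop :=
  ∀ f ∈ F, ∃ g ∈ F, ∀ᶠ n in atTop, g n ≤ h n (f n)

def GeStarDirected (F : Set (ℕ → ℕ)) : Prop :=
  ∀ f₀ ∈ F, ∀ f₁ ∈ F, ∃ g ∈ F, ∀ᶠ n in atTop, g n ≤ min (f₀ n) (f₁ n)

/-! ## Finite sequences -/

/-- Finite sequences, the elements of `⋃ n, ∏ i < n, H i`. -/
@[ext]
structure FinSeq (H : ℕ → Type u) where
  len : ℕ
  term : ∀ i : Fin len, H i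

namespace FinSeq

variable {H : ℕ → Type u}

/-- `s` has length greater than `n` and its term with index `n` is `a`. -/
def At (s : FinSeq H) (n : ℕ) (a : H n) : Prop := ∃ hn : n < s.len, s.term ⟨n, hn⟩ = a

/-- The restriction of `s` to `m` (all of `s` if its length is at most `m`). -/
def restrict (s : FinSeq H) (m : ℕ) : FinSeq H :=
  ⟨min m s.len, fun i => s.term ⟨i, lt_of_lt_of_le i.2 (min_le_right _ _)⟩⟩

/-- `s` is an initial segment of `t`. -/
def Init (s t : FinSeq H) : Prop := s.len ≤ t.len ∧ t.restrict s.len = s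

/-- `s` is a proper initial segment of `t`. -/
def ProperInit (s t : FinSeq H) : Prop := s.len < t.len ∧ t.restrict s.len = s

/-- `s` extended by one more term `a`. -/
def snoc (s : FinSeq H) (a : H s.len) : FinSeq H :=
  ⟨s.len + 1, fun i => if hi : (i : ℕ) < s.len then s.term ⟨i, hi⟩ else
    (Nat.le_antisymm (not_lt.1 hi) (Nat.lt_succ_iff.1 i.2)) ▸ a⟩

/-- The sequence of the length of `v` which agrees with `w` below the length of `w`, and with `v`
from there on. -/
def overwrite (w v : FinSeq H) : FinSeq H :=
  ⟨v.len, fun i => if hi : (i : ℕ) < w.len then w.term ⟨i, hi⟩ else v.term i⟩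

end FinSeq

/-! ## Creatures and creating pairs -/

/-- A creature for `H`, with the component `dis` taken from `D`. Since `val` is non-empty, the
numbers `dn` and `up` are determined by it. -/
structure Creature (H : ℕ → Type u) (D : Type v) where
  nor : ℝ≥0
  val : Set (FinSeq H × FinSeq H)
  dis : D
  dn : ℕ
  up : ℕ
  dn_lt_up : dn < up
  val_nonempty : val.Nonempty
  val_spec : ∀ x ∈ val, x.1.len = dn ∧ x.2.len = up ∧ x.1.ProperInit x.2

namespace Creature

variable {H : ℕ → Type u} {D : Type v}

/-- The domain of the relation `val`. -/
def dom (t : Creature H D) : Set (FinSeq H) := {x | ∃ y, (x, y) ∈ t.val}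

/-- Consecutive creatures among `t 0, …, t k` fit together. -/
def Chained (t : ℕ → Creature H D) (k : ℕ) : Prop := ∀ i < k, (t i).up = (t (i + 1)).dn

/-- The set `pos(w, t 0, …, t n)`. -/
def pos (w : FinSeq H) (t : ℕ → Creature H D) (n : ℕ) : Set (FinSeq H) :=
  {x | x.len = (t n).up ∧ w.ProperInit x ∧
    ∀ i ≤ n, (x.restrict (t i).dn, x.restrict (t i).up) ∈ (t i).val}

end Creature

/-- A creating pair `(K, Σ)` for `H`. Only the values of `Sig` at finite subsets of `K` matter. -/
structure CreatingPair (H : ℕ → Type u) (D : Type v) where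
  K : Set (Creature H D)
  Sig : Set (Creature H D) → Set (Creature H D)
  sig_sub : ∀ S ⊆ K, S.Finite → Sig S ⊆ K
  sig_enum : ∀ S ⊆ K, S.Finite → (Sig S).Nonempty →
    ∃ (k : ℕ) (t : ℕ → Creature H D), S = t '' Set.Iic k ∧ Creature.Chained t k
  sig_ends : ∀ (k : ℕ) (t : ℕ → Creature H D), (∀ i ≤ k, t i ∈ K) → Creature.Chained t k →
    ∀ s ∈ Sig (t '' Set.Iic k), s.dn = (t 0).dn ∧ s.up = (t k).up
  sig_self : ∀ t ∈ K, t ∈ Sig {t}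
  sig_empty : Sig ∅ = ∅
  sig_trans : ∀ (n : ℕ) (s : ℕ → Creature H D) (T : ℕ → Set (Creature H D)),
    Creature.Chained s n → (∀ i ≤ n, T i ⊆ K ∧ (T i).Finite ∧ s i ∈ Sig (T i)) →
    Sig (s '' Set.Iic n) ⊆ Sig (⋃ i ∈ Set.Iic n, T i)
  sig_nice : ∀ (k : ℕ) (t : ℕ → Creature H D), (∀ i ≤ k, t i ∈ K) → Creature.Chained t k →
    ∀ s ∈ Sig (t '' Set.Iic k), (t 0).dom = s.dom ∧
      ∀ x ∈ s.val, ∀ i ≤ k, (x.2.restrict (t i).dn, x.2.restrict (t i).up) ∈ (t i).val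

namespace CreatingPair

variable {H : ℕ → Type u} {D : Type v}

def Local (C : CreatingPair H D) : Prop := ∀ t ∈ C.K, t.up = t.dn + 1

def Forgetful (C : CreatingPair H D) : Prop :=
  ∀ t ∈ C.K, ∀ x y w : FinSeq H, (x, y) ∈ t.val → w.len = t.dn → (w, w.overwrite y) ∈ t.val

def HLinked (C : CreatingPair H D) (h : ℕ → ℕ → ℕ) : Prop :=
  ∀ k : ℕ, 1 < k → ∀ t₀ ∈ C.K, ∀ t₁ ∈ C.K, (k : ℝ≥0) ≤ t₀.nor → (k : ℝ≥0) ≤ t₁.nor →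
    t₀.dn = t₁.dn → t₀.up = t₁.up →
    ∃ s, s ∈ C.Sig {t₀} ∩ C.Sig {t₁} ∧ (h t₀.dn k : ℝ≥0) ≤ s.nor

def CohenProducing (C : CreatingPair H D) : Prop :=
  ∀ n : ℕ, ∃ A : Set (H n), ∀ t ∈ C.K, 1 < t.nor → ∀ x ∈ t.dom, x.len = n →
    ∃ y₀ y₁, (x, y₀) ∈ t.val ∧ (x, y₁) ∈ t.val ∧
      (∃ a ∈ A, y₁.At n a) ∧ (∃ a, a ∉ A ∧ y₀.At n a)

/-- The BCB--type. The finite set `E` is the set of the exceptional values. -/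
def BCB (C : CreatingPair H D) : Prop :=
  C.Local ∧ C.Forgetful ∧
  ∀ (i : ℕ) (s : ℕ → Creature H D), (∀ n, s n ∈ C.K ∧ (s n).dn = i ∧ 2 ≤ (s n).nor) →
    ∃ (E : Finset (H i)) (n : ℕ → ℕ), StrictMono n ∧ ∀ a ∉ E, ∀ᶠ k in atTop,
      ∀ x : (∀ j : Fin i, H j), (⟨i, x⟩ : FinSeq H) ∈ (s (n k)).dom →
        ((⟨i, x⟩ : FinSeq H), FinSeq.snoc (⟨i, x⟩ : FinSeq H) a) ∈ (s (n k)).val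

/-- Conditions without any demand on the norms. -/
structure PreCond (C : CreatingPair H D) where
  w : FinSeq H
  t : ℕ → Creature H D
  mem : ∀ i, t i ∈ C.K
  chain : ∀ i, (t i).up = (t (i + 1)).dn
  w_mem : w ∈ (t 0).dom
  pos_sub : ∀ i, Creature.pos w t i ⊆ (t (i + 1)).dom

/-- `q` results from `p` by deciding the value. -/
def Decide (C : CreatingPair H D) (p q : C.PreCond) : Prop :=
  ∃ n : ℕ, q.w ∈ Creature.pos p.w p.t n ∧ ∀ i, q.t i = p.t (n + 1 + i)

/-- `q` results from `p` by applying `Σ`. -/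
def Apply (C : CreatingPair H D) (p q : C.PreCond) : Prop :=
  q.w = p.w ∧ ∃ n : ℕ → ℕ, n 0 = 0 ∧ StrictMono n ∧
    ∀ i, q.t i ∈ C.Sig (p.t '' Set.Ico (n i) (n (i + 1)))

/-- The conditions of the forcing notion `ℚ*_F(K, Σ)`. -/
def Cond (C : CreatingPair H D) (F : Set (ℕ → ℕ)) : Type (max u v) :=
  {p : C.PreCond // ∃ f ∈ F, ∀ᶠ i in atTop, (f (p.t i).dn : ℝ≥0) ≤ (p.t i).nor}

/-- The order of `ℚ*_F(K, Σ)`: finitely many applications of the two operations, where the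
intermediate results need not satisfy the norm condition. -/
def le (C : CreatingPair H D) (F : Set (ℕ → ℕ)) (p q : C.Cond F) : Prop :=
  Relation.ReflTransGen (fun a b : C.PreCond => C.Decide a b ∨ C.Apply a b) p.1 q.1

end CreatingPair

/-! ## Tree-creatures and tree-creating pairs -/

/-- A local tree--creature for `H`; `base` is the sequence `η` with `dom val = {η}`. -/
structure TreeCreature (H : ℕ → Type u) (D : Type v) where
  nor : ℝ≥0
  val : Set (FinSeq H × FinSeq H)
  dis : D
  base : FinSeq H
  val_nonempty : val.Nonempty
  val_spec : ∀ x ∈ val, x.1 = base ∧ x.2.len = base.len + 1 ∧ base.ProperInit x.2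

/-- The range of the relation `val`. -/
def TreeCreature.pos {H : ℕ → Type u} {D : Type v} (t : TreeCreature H D) : Set (FinSeq H) :=
  {y | ∃ x, (x, y) ∈ t.val}

/-- A local tree--creating pair `(K, Σ)` for `H`. Only the values of `Sig` on `K` matter. -/
structure TreeCreatingPair (H : ℕ → Type u) (D : Type v) where
  K : Set (TreeCreature H D)
  Sig : TreeCreature H D → Set (TreeCreature H D)
  sig_sub : ∀ t ∈ K, Sig t ⊆ K
  sig_base : ∀ t ∈ K, ∀ s ∈ Sig t, s.base = t.base
  sig_val : ∀ t ∈ K, ∀ s ∈ Sig t, s.val ⊆ t.val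
  sig_trans : ∀ t ∈ K, ∀ s ∈ Sig t, Sig s ⊆ Sig t

namespace TreeCreatingPair

variable {H : ℕ → Type u} {D : Type v}

def HLinked (C : TreeCreatingPair H D) (h : ℕ → ℕ → ℕ) : Prop :=
  ∀ k : ℕ, 1 < k → ∀ t₀ ∈ C.K, ∀ t₁ ∈ C.K, t₀.base = t₁.base →
    (k : ℝ≥0) ≤ t₀.nor → (k : ℝ≥0) ≤ t₁.nor →
    ∃ s, s ∈ C.Sig t₀ ∩ C.Sig t₁ ∧ (h t₀.base.len k : ℝ≥0) ≤ s.nor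

def CohenProducing (C : TreeCreatingPair H D) : Prop :=
  ∀ n : ℕ, ∃ A : Set (H n), ∀ t ∈ C.K, 1 < t.nor → t.base.len = n →
    ∃ y₀ ∈ t.pos, ∃ y₁ ∈ t.pos, (∃ a ∈ A, y₁.At n a) ∧ (∃ a, a ∉ A ∧ y₀.At n a)

/-- The BCB--type for trees. The finite set `E` is the set of the exceptional values. -/
def BCB (C : TreeCreatingPair H D) : Prop :=
  ∀ (η : FinSeq H) (s : ℕ → TreeCreature H D),
    (∀ n, s n ∈ C.K ∧ (s n).base = η ∧ 2 ≤ (s n).nor) →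
    ∃ (E : Finset (H η.len)) (n : ℕ → ℕ), StrictMono n ∧ ∀ a ∉ E, ∀ᶠ k in atTop,
      η.snoc a ∈ (s (n k)).pos

/-- The conditions of the forcing notion `ℚ^tree_F(K, Σ)`: systems of tree--creatures indexed by a
tree `T` without maximal nodes. -/
structure Cond (C : TreeCreatingPair H D) (F : Set (ℕ → ℕ)) where
  T : Set (FinSeq H)
  t : T → TreeCreature H D
  tree : ∃ root ∈ T, (∀ ν ∈ T, root.Init ν) ∧ ∀ ν η, root.Init ν → ν.Init η → η ∈ T → ν ∈ T
  no_max : ∀ ν ∈ T, ∃ ρ ∈ T, ν.ProperInit ρ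
  mem : ∀ η, t η ∈ C.K
  base_eq : ∀ η, (t η).base = η
  pos_eq : ∀ η, (t η).pos = {ν ∈ T | η.1.ProperInit ν ∧ ν.len = η.1.len + 1}
  norm : ∃ f ∈ F, ∃ N : ℕ, ∀ η, N ≤ η.1.len → (f η.1.len : ℝ≥0) ≤ (t η).nor

/-- The order of `ℚ^tree_F(K, Σ)`. -/
def le (C : TreeCreatingPair H D) (F : Set (ℕ → ℕ)) (p q : C.Cond F) : Prop :=
  ∃ hsub : q.T ⊆ p.T, ∀ η : q.T, q.t η ∈ C.Sig (p.t ⟨η.1, hsub η.2⟩)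

end TreeCreatingPair

namespace Forcing

variable {P : Type u} {le : P → P → Prop}

theorem FunName.forces_of_mem {α : Type v} (htrans : ∀ p q r, le p q → le q r → le p r)
    (hext : ∀ p, ∃ q, le p q) (g : FunName le α) {p : P} {n : ℕ} {a : α} (hp : p ∈ g.val n a)
    {S : Set α} (ha : a ∈ S) : g.Forces p n S := by
  intro q hq
  obtain ⟨r, hr⟩ := hext q
  exact ⟨a, ha, p, hp, r, hr, htrans _ _ _ hq hr⟩

/-- Every predense set is refined by a maximal antichain. -/
theorem exists_maximalAntichain_refining (htrans : ∀ p q r, le p q → le q r → le p r)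
    (hext : ∀ p, ∃ q, le p q) (S : Set P) (hS : ∀ p, ∃ q ∈ S, Compat le p q) :
    ∃ A : Set P, IsMaximalAntichain le A ∧ ∀ p ∈ A, ∃ q ∈ S, le q p := by
  obtain ⟨A, hA⟩ := zorn_subset {A : Set P | IsAntichain le A ∧ ∀ p ∈ A, ∃ q ∈ S, le q p} (by
    intro c hc hchain
    refine ⟨⋃₀ c, ⟨?_, ?_⟩, fun s hs => Set.subset_sUnion_of_mem hs⟩
    · rintro p ⟨s, hs, hps⟩ q ⟨t, ht, hqt⟩ hpq
      rcases hchain.total hs ht with hst | hst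
      · exact (hc ht).1 p (hst hps) q hqt hpq
      · exact (hc hs).1 p hps q (hst hqt) hpq
    · rintro p ⟨s, hs, hps⟩
      exact (hc hs).2 p hps)
  refine ⟨A, ⟨hA.prop.1, fun q => ?_⟩, hA.prop.2⟩
  by_contra! hq
  obtain ⟨s, hs, r, hqr, hsr⟩ := hS q
  have hrA : ∀ p ∈ A, ¬ Compat le r p := fun p hp ⟨x, hrx, hpx⟩ =>
    hq p hp ⟨x, htrans _ _ _ hqr hrx, hpx⟩
  have hins : insert r A ∈ {A : Set P | IsAntichain le A ∧ ∀ p ∈ A, ∃ q ∈ S, le q p} := by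
    refine ⟨?_, ?_⟩
    · rintro p (rfl | hp) q (rfl | hq) hpq
      · exact absurd rfl hpq
      · exact hrA q hq
      · exact fun ⟨x, h1, h2⟩ => hrA p hp ⟨x, h2, h1⟩
      · exact hA.prop.1 p hp q hq hpq
    · rintro p (rfl | hp)
      · exact ⟨s, hs, hsr⟩
      · exact hA.prop.2 p hp
  have hr : r ∈ A := hA.le_of_ge hins (Set.subset_insert r A) (Set.mem_insert r A)
  obtain ⟨x, hx⟩ := hext r
  exact hrA r hr ⟨x, hx, hx⟩

theorem exists_dominating_countable (G : ℕ → ℕ → ℕ) :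
    ∃ g : ℕ → ℕ, ∀ m, ∀ n ≥ m, G m n ≤ g n :=
  ⟨fun n => ∑ m ∈ Finset.range (n + 1), G m n, fun _ n hmn =>
    Finset.single_le_sum (f := fun m => G m n) (fun _ _ => Nat.zero_le _)
      (Finset.mem_range.2 (Nat.lt_succ_of_le hmn))⟩

theorem Nice.preservesUnbounded (htrans : ∀ p q r, le p q → le q r → le p r)
    (hext : ∀ p, ∃ q, le p q) (hnice : Nice le) : PreservesUnbounded le := by
  intro B hB g p₀
  obtain ⟨hccc, c, hc⟩ := hnice
  have hbound : ∀ m n, ∃ b, ∀ q, c q = m → ∃ k ≤ b, ∃ s ∈ g.val n k, Compat le q s := by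
    intro m n
    obtain ⟨A, hA, hAS⟩ := exists_maximalAntichain_refining htrans hext (⋃ a, g.val n a) (by
      intro p
      obtain ⟨a, q, hq, hpq⟩ := g.predense n p
      exact ⟨q, Set.mem_iUnion.2 ⟨a, hq⟩, hpq⟩)
    have hne : A.Nonempty := let ⟨p, hp, _⟩ := hA.2 p₀; ⟨p, hp⟩
    obtain ⟨e, rfl⟩ := (hccc A hA.1).exists_eq_range hne
    have : ∀ i, ∃ k, ∃ s ∈ g.val n k, le s (e i) := by
      intro i
      obtain ⟨s, hs, hse⟩ := hAS (e i) ⟨i, rfl⟩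
      obtain ⟨k, hk⟩ := Set.mem_iUnion.1 hs
      exact ⟨k, s, hk, hse⟩
    choose k s hs hse using this
    obtain ⟨N, hN⟩ := hc e hA m
    refine ⟨∑ i ∈ Finset.range N, k i, fun q hq => ?_⟩
    obtain ⟨i, hi, r, hqr, her⟩ := hN q hq
    exact ⟨k i, Finset.single_le_sum (fun _ _ => Nat.zero_le _) (Finset.mem_range.2 hi), s i, hs i,
      r, hqr, htrans _ _ _ (hse i) her⟩
  choose G hG using hbound
  obtain ⟨d, hd⟩ := exists_dominating_countable G
  have hBd : ∃ f ∈ B, ∃ᶠ n in atTop, d n < f n := by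
    by_contra! hcon
    exact hB ⟨d, hcon⟩
  obtain ⟨f, hf, hfd⟩ := hBd
  obtain ⟨q, hq⟩ := hext p₀
  refine ⟨q, hq, f, hf, fun m r _ => ?_⟩
  obtain ⟨n, hn, hfn⟩ := frequently_atTop.1 hfd (max (m + 1) (c r))
  obtain ⟨k, hk, s, hs, x, hrx, hsx⟩ := hG (c r) n r rfl
  refine ⟨x, hrx, n, lt_of_lt_of_le (Nat.lt_succ_self m) ((le_max_left _ _).trans hn), ?_⟩
  intro y hxy
  obtain ⟨z, hz⟩ := hext y
  have := hd (c r) n ((le_max_right _ _).trans hn)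
  exact ⟨k, lt_of_le_of_lt (hk.trans this) hfn, s, hs, z, hz,
    htrans _ _ _ hsx (htrans _ _ _ hxy hz)⟩

/-- A criterion for niceness: a dense set is the union of countably many linked pieces, and for
every sequence in a piece some condition forces infinitely many of its terms into the generic
filter. -/
theorem nice_of_linked_limits {ι : Type v} [Countable ι]
    (htrans : ∀ p q r, le p q → le q r → le p r) (piece : ι → Set P)
    (hdense : ∀ p, ∃ i, ∃ q ∈ piece i, le p q)
    (hlinked : ∀ i, ∀ p ∈ piece i, ∀ q ∈ piece i, Compat le p q)
    (hlimit : ∀ i, ∀ q : ℕ → P, (∀ n, q n ∈ piece i) →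
      ∃ p, ∀ r, le p r → ∃ᶠ n in atTop, Compat le r (q n)) : Nice le := by
  obtain ⟨e, he⟩ := exists_injective_nat ι
  choose idx d hd hle using hdense
  refine ⟨fun A hA => ?_, fun p => e (idx p), fun p hp m => ?_⟩
  · have hinj : Set.InjOn (fun p => e (idx p)) A := by
      intro p hp q hq hpq
      by_contra hne
      have hi : idx p = idx q := he hpq
      obtain ⟨r, h1, h2⟩ := hlinked _ _ (hd p) _ (hi ▸ hd q)
      exact hA p hp q hq hne ⟨r, htrans _ _ _ (hle p) h1, htrans _ _ _ (hle q) h2⟩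
    exact Set.MapsTo.countable_of_injOn (Set.mapsTo_univ _ A) hinj Set.countable_univ
  · by_contra! hcon
    choose q hqm hq using hcon
    have hidx : ∀ n, idx (q n) = idx (q 0) := fun n => he ((hqm n).trans (hqm 0).symm)
    obtain ⟨x, hx⟩ := hlimit (idx (q 0)) (fun n => d (q n)) fun n => hidx n ▸ hd (q n)
    obtain ⟨_, ⟨k, rfl⟩, r, hxr, hkr⟩ := hp.2 x
    obtain ⟨n, hkn, y, hry, hny⟩ := frequently_atTop.1 (hx r hxr) (k + 1)
    exact hq n k hkn ⟨y, htrans _ _ _ (hle _) hny, htrans _ _ _ hkr hry⟩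

/-- A criterion for adding a Cohen real: conditions decide initial segments of a name in such a
way that below each condition some segment can be extended arbitrarily. -/
theorem addsCohenReal_of_decides (htrans : ∀ p q r, le p q → le q r → le p r)
    (dec : P → List Bool → Prop) (hmono : ∀ p q s, le p q → dec p s → dec q s)
    (hcoh : ∀ (p : P) (s t : List Bool), dec p s → dec p t →
      ∀ (n : ℕ) (a b : Bool), s[n]? = some a → t[n]? = some b → a = b)
    (hfree : ∀ p, ∃ s : List Bool, ∀ t, s <+: t → ∃ q, le p q ∧ dec q t) :
    AddsCohenReal le := by
  have hext : ∀ p, ∃ q, le p q := fun p =>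
    let ⟨s, hs⟩ := hfree p
    let ⟨q, hq, _⟩ := hs s (List.prefix_refl s)
    ⟨q, hq⟩
  let c : FunName le Bool :=
    { val := fun n b => {p | ∃ s, dec p s ∧ s[n]? = some b}
      predense := by
        intro n p
        obtain ⟨s, hs⟩ := hfree p
        obtain ⟨q, hpq, hq⟩ := hs (s ++ List.replicate (n + 1) true) (List.prefix_append _ _)
        obtain ⟨r, hr⟩ := hext q
        have hn : n < (s ++ List.replicate (n + 1) true).length := by simp; omega
        exact ⟨_, q, ⟨_, hq, List.getElem?_eq_getElem hn⟩, r, htrans _ _ _ hpq hr, hr⟩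
      unique := by
        rintro n a b p ⟨s, hs, hsa⟩ q ⟨t, ht, htb⟩ ⟨r, hpr, hqr⟩
        exact hcoh r s t (hmono _ _ _ hpr hs) (hmono _ _ _ hqr ht) n a b hsa htb }
  refine ⟨c, fun D hD p => ?_⟩
  obtain ⟨s, hs⟩ := hfree p
  obtain ⟨t, htD, hst⟩ := hD s
  obtain ⟨q, hpq, hq⟩ := hs t hst
  exact ⟨q, hpq, t, htD, fun i hi => c.forces_of_mem htrans hext
    (show q ∈ c.val i t[i] from ⟨t, hq, List.getElem?_eq_getElem hi⟩) rfl⟩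

end Forcing

/-- If every sequence of indices in `V` has a subsequence along which all but finitely many points
are eventually in the sets `S n`, then some `S n` is included in the limit of `S` along `U`. -/
theorem Ultrafilter.exists_subset_limit {α : Type u} (U : Ultrafilter ℕ) {V : Set ℕ}
    (hV : V ∈ U) (S : ℕ → Set α)
    (hS : ∀ φ : ℕ → ℕ, (∀ k, φ k ∈ V) → ∃ (E : Finset α) (n : ℕ → ℕ), StrictMono n ∧
      ∀ a ∉ E, ∀ᶠ k in atTop, a ∈ S (φ (n k))) :
    ∃ n ∈ V, ∀ a ∈ S n, ∀ᶠ m in (U : Filter ℕ), a ∈ S m := by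
  have hfin : {a | ∀ᶠ m in (U : Filter ℕ), a ∉ S m}.Finite := by
    by_contra hinf
    let e := Set.Infinite.natEmbedding _ hinf
    have : ∀ k : ℕ, ∃ m ∈ V, ∀ j < k, (e j : α) ∉ S m := by
      intro k
      have h1 : ∀ᶠ m in (U : Filter ℕ), ∀ j ∈ Finset.range k, (e j : α) ∉ S m :=
        (Filter.eventually_all_finset _).2 fun j _ => (e j).2
      obtain ⟨m, hm, hmV⟩ := (h1.and hV).exists
      exact ⟨m, hmV, fun j hj => hm j (Finset.mem_range.2 hj)⟩
    choose φ hφV hφ using this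
    obtain ⟨E, n, hn, hE⟩ := hS φ hφV
    have hinj : Function.Injective fun j => (e j : α) := Subtype.val_injective.comp e.injective
    obtain ⟨j, hj⟩ := (Set.infinite_range_of_injective hinj).exists_notMem_finset E
    obtain ⟨⟨j, rfl⟩, hjE⟩ := hj
    obtain ⟨k, hk, hjk⟩ := ((hE _ hjE).and (eventually_ge_atTop (j + 1))).exists
    exact hφ (n k) j (lt_of_lt_of_le hjk (hn.id_le k)) hk
  have h1 : ∀ᶠ m in (U : Filter ℕ), ∀ a ∈ {a | ∀ᶠ m in (U : Filter ℕ), a ∉ S m}, a ∉ S m :=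
    (Filter.eventually_all_finite hfin).2 fun a ha => ha
  obtain ⟨n, hn, hnV⟩ := (h1.and hV).exists
  refine ⟨n, hnV, fun a ha => ?_⟩
  by_contra hcon
  exact hn a (Ultrafilter.eventually_not.2 hcon) ha

namespace FinSeq

variable {H : ℕ → Type u}

instance [∀ n, Countable (H n)] : Countable (FinSeq H) :=
  Function.Injective.countable
    (f := fun s : FinSeq H => (⟨s.len, s.term⟩ : Σ n, ∀ i : Fin n, H i)) (by
      rintro ⟨m, x⟩ ⟨n, y⟩ hxy
      simp only [Sigma.mk.injEq] at hxy
      obtain ⟨rfl, hxy⟩ := hxy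
      rw [eq_of_heq hxy])

theorem At.lt {s : FinSeq H} {n : ℕ} {a : H n} (hs : s.At n a) : n < s.len := hs.1

theorem At.unique {s : FinSeq H} {n : ℕ} {a b : H n} (ha : s.At n a) (hb : s.At n b) : a = b :=
  ha.2.symm.trans hb.2

theorem exists_at {s : FinSeq H} {n : ℕ} (hn : n < s.len) : ∃ a, s.At n a := ⟨_, hn, rfl⟩

theorem eq_of_at {s t : FinSeq H} (hlen : s.len = t.len) (hat : ∀ i a, s.At i a → t.At i a) :
    s = t := by
  obtain ⟨m, x⟩ := s
  obtain ⟨n, y⟩ := t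
  obtain rfl : m = n := hlen
  congr 1
  funext i
  obtain ⟨_, hi⟩ := hat i (x i) ⟨i.2, rfl⟩
  exact hi.symm

theorem at_restrict {s : FinSeq H} {m i : ℕ} {a : H i} :
    (s.restrict m).At i a ↔ i < m ∧ s.At i a :=
  ⟨fun ⟨hi, ha⟩ => ⟨lt_of_lt_of_le hi (min_le_left _ _), lt_of_lt_of_le hi (min_le_right _ _), ha⟩,
    fun ⟨hm, hi, ha⟩ => ⟨lt_min hm hi, ha⟩⟩

theorem restrict_len {s : FinSeq H} {m : ℕ} (hm : m ≤ s.len) : (s.restrict m).len = m :=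
  min_eq_left hm

theorem init_iff {s t : FinSeq H} :
    s.Init t ↔ s.len ≤ t.len ∧ ∀ i a, s.At i a → t.At i a := by
  refine ⟨fun ⟨h1, h2⟩ => ⟨h1, fun i a ha => ?_⟩, fun ⟨h1, h2⟩ => ⟨h1, ?_⟩⟩
  · rw [← h2] at ha
    exact (at_restrict.1 ha).2
  · exact (eq_of_at (restrict_len h1).symm fun i a ha => at_restrict.2 ⟨ha.lt, h2 i a ha⟩).symm

theorem Init.at {s t : FinSeq H} (hst : s.Init t) {i : ℕ} {a : H i} (ha : s.At i a) : t.At i a :=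
  (init_iff.1 hst).2 i a ha

theorem Init.at_of_lt {s t : FinSeq H} (hst : s.Init t) {i : ℕ} {a : H i} (ha : t.At i a)
    (hi : i < s.len) : s.At i a := by
  obtain ⟨b, hb⟩ := exists_at hi
  rwa [ha.unique (hst.at hb)]

theorem Init.refl (s : FinSeq H) : s.Init s := init_iff.2 ⟨le_rfl, fun _ _ => id⟩

theorem Init.trans {s t r : FinSeq H} (h1 : s.Init t) (h2 : t.Init r) : s.Init r :=
  init_iff.2 ⟨h1.1.trans h2.1, fun _ _ ha => h2.at (h1.at ha)⟩

theorem Init.eq_of_len_le {s t : FinSeq H} (hst : s.Init t) (hle : t.len ≤ s.len) : s = t :=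
  eq_of_at (le_antisymm hst.1 hle) fun _ _ => hst.at

theorem Init.of_len_le {s t r : FinSeq H} (hs : s.Init r) (ht : t.Init r) (hle : s.len ≤ t.len) :
    s.Init t :=
  init_iff.2 ⟨hle, fun _ _ ha => ht.at_of_lt (hs.at ha) (lt_of_lt_of_le ha.lt hle)⟩

theorem ProperInit.init {s t : FinSeq H} (hst : s.ProperInit t) : s.Init t := ⟨hst.1.le, hst.2⟩

theorem Init.proper {s t : FinSeq H} (hst : s.Init t) (hlt : s.len < t.len) : s.ProperInit t :=
  ⟨hlt, hst.2⟩

theorem Init.restrict_eq {s t : FinSeq H} (hst : s.Init t) {m : ℕ} (hm : s.len = m) :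
    t.restrict m = s := hm ▸ hst.2

theorem restrict_init (s : FinSeq H) (m : ℕ) : (s.restrict m).Init s :=
  init_iff.2 ⟨min_le_right _ _, fun _ _ ha => (at_restrict.1 ha).2⟩

theorem snoc_at_of_at {s : FinSeq H} {a : H s.len} {i : ℕ} {b : H i} (hb : s.At i b) :
    (s.snoc a).At i b := by
  obtain ⟨hi, hb⟩ := hb
  refine ⟨Nat.lt_succ_of_lt hi, ?_⟩
  simp only [snoc, hi, dif_pos, hb]

theorem snoc_at_len (s : FinSeq H) (a : H s.len) : (s.snoc a).At s.len a := by
  refine ⟨Nat.lt_succ_self _, ?_⟩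
  simp only [snoc, lt_irrefl, dif_neg, not_false_eq_true]

theorem Init.eq_snoc {s t : FinSeq H} (hst : s.Init t) (hlen : t.len = s.len + 1) {a : H s.len}
    (ha : t.At s.len a) : t = s.snoc a := by
  refine (eq_of_at hlen.symm fun i b hb => ?_).symm
  rcases Nat.lt_succ_iff_lt_or_eq.1 hb.lt with hi | rfl
  · obtain ⟨c, hc⟩ := exists_at hi
    rw [hb.unique (snoc_at_of_at hc)]
    exact hst.at hc
  · rwa [hb.unique (snoc_at_len s a)]

theorem overwrite_at {w v : FinSeq H} {i : ℕ} {a : H i} (ha : (w.overwrite v).At i a) :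
    w.At i a ∨ w.len ≤ i ∧ v.At i a := by
  obtain ⟨hi, ha⟩ := ha
  by_cases hw : i < w.len
  · simp only [overwrite, hw, dif_pos] at ha
    exact Or.inl ⟨hw, ha⟩
  · simp only [overwrite, hw, dif_neg, not_false_eq_true] at ha
    exact Or.inr ⟨not_lt.1 hw, hi, ha⟩

/-- The sequence of truth values of `s n ∈ A n` begins with `x`. -/
def Decides (A : ∀ n, Set (H n)) (s : FinSeq H) (x : List Bool) : Prop :=
  ∀ n b, x[n]? = some b → ∃ a, s.At n a ∧ (a ∈ A n ↔ b = true)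

variable {A : ∀ n, Set (H n)}

theorem Decides.of_init {s t : FinSeq H} {x : List Bool} (hs : s.Decides A x) (hst : s.Init t) :
    t.Decides A x := fun n b hb =>
  let ⟨a, ha, hab⟩ := hs n b hb
  ⟨a, hst.at ha, hab⟩

theorem Decides.eq_of_getElem? {s : FinSeq H} {x y : List Bool} (hx : s.Decides A x)
    (hy : s.Decides A y) {n : ℕ} {b c : Bool} (hb : x[n]? = some b) (hc : y[n]? = some c) :
    b = c := by
  obtain ⟨a, ha, hab⟩ := hx n b hb
  obtain ⟨d, hd, hdc⟩ := hy n c hc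
  obtain rfl := ha.unique hd
  exact Bool.eq_iff_iff.2 (hab.symm.trans hdc)

theorem exists_decides (A : ∀ n, Set (H n)) (s : FinSeq H) :
    ∃ x : List Bool, x.length = s.len ∧ s.Decides A x := by
  classical
  refine ⟨List.ofFn fun i : Fin s.len => decide (s.term i ∈ A i), by simp, fun n b hb => ?_⟩
  obtain ⟨hn, rfl⟩ := List.getElem?_eq_some_iff.1 hb
  rw [List.length_ofFn] at hn
  exact ⟨s.term ⟨n, hn⟩, ⟨hn, rfl⟩, by simp⟩

theorem Decides.append_singleton {s t : FinSeq H} {x : List Bool} (hs : s.Decides A x)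
    (hst : s.Init t) (hx : x.length = s.len) {a : H s.len} (ha : t.At s.len a) {b : Bool}
    (hab : a ∈ A s.len ↔ b = true) : t.Decides A (x ++ [b]) := by
  intro n c hc
  rcases lt_or_ge n x.length with hn | hn
  · rw [List.getElem?_append_left hn] at hc
    exact hs.of_init hst n c hc
  · rw [List.getElem?_append_right hn, List.getElem?_singleton] at hc
    split_ifs at hc with h0
    obtain rfl : n = s.len := by omega
    obtain rfl : b = c := by simpa using hc
    exact ⟨a, ha, hab⟩

end FinSeq

namespace TreeCreature

variable {H : ℕ → Type u} {D : Type v}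

theorem of_mem_pos {t : TreeCreature H D} {ρ : FinSeq H} (hρ : ρ ∈ t.pos) :
    t.base.ProperInit ρ ∧ ρ.len = t.base.len + 1 :=
  let ⟨_, hx⟩ := hρ
  ⟨(t.val_spec _ hx).2.2, (t.val_spec _ hx).2.1⟩

theorem pos_nonempty (t : TreeCreature H D) : t.pos.Nonempty :=
  let ⟨x, hx⟩ := t.val_nonempty
  ⟨x.2, x.1, hx⟩

/-- The nodes that are reached from the root `η` by means of the tree-creatures `s ν`. -/
inductive Generated (s : FinSeq H → TreeCreature H D) (η : FinSeq H) : FinSeq H → Prop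
  | root : Generated s η η
  | step {ν ρ : FinSeq H} : Generated s η ν → ρ ∈ (s ν).pos → Generated s η ρ

end TreeCreature

namespace TreeCreatingPair

open TreeCreature

variable {H : ℕ → Type u} {D : Type v} {C : TreeCreatingPair H D} {F : Set (ℕ → ℕ)}

theorem cond_le_trans (p q r : C.Cond F) (hpq : C.le F p q) (hqr : C.le F q r) : C.le F p r := by
  obtain ⟨h1, h2⟩ := hpq
  obtain ⟨h3, h4⟩ := hqr
  exact ⟨h3.trans h1, fun η => C.sig_trans _ (p.mem _) _ (h2 ⟨η.1, h3 η.2⟩) (h4 η)⟩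

theorem exists_cond (s : FinSeq H → TreeCreature H D) (Good : Set (FinSeq H)) (η : FinSeq H)
    (hη : η ∈ Good) (hK : ∀ ν ∈ Good, s ν ∈ C.K) (hbase : ∀ ν ∈ Good, (s ν).base = ν)
    (hpos : ∀ ν ∈ Good, (s ν).pos ⊆ Good)
    (hnor : ∃ f ∈ F, ∃ N, ∀ ν ∈ Good, N ≤ ν.len → (f ν.len : ℝ≥0) ≤ (s ν).nor) :
    ∃ q : C.Cond F, η ∈ q.T ∧ (∀ ν ∈ q.T, η.Init ν ∧ ν ∈ Good) ∧ ∀ ν, q.t ν = s ν.1 := by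
  have hgood : ∀ ν, Generated s η ν → η.Init ν ∧ ν ∈ Good := by
    intro ν hν
    induction hν with
    | root => exact ⟨FinSeq.Init.refl _, hη⟩
    | step _ hρ ih =>
      have := of_mem_pos hρ
      rw [hbase _ ih.2] at this
      exact ⟨ih.1.trans this.1.init, hpos _ ih.2 hρ⟩
  have hcl : ∀ ν ρ, η.Init ν → ν.Init ρ → Generated s η ρ → Generated s η ν := by
    intro ν ρ hν hνρ hρ
    induction hρ with
    | root => exact (hνρ.eq_of_len_le hν.1) ▸ Generated.root
    | @step σ ρ hσ hρ ih =>
      have hσρ := of_mem_pos hρ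
      rw [hbase _ (hgood σ hσ).2] at hσρ
      rcases Nat.lt_or_ge σ.len ν.len with hlt | hge
      · rw [hνρ.eq_of_len_le (by omega)]
        exact hσ.step hρ
      · exact ih (hνρ.of_len_le hσρ.1.init hge)
  refine ⟨⟨{ν | Generated s η ν}, fun ν => s ν.1, ⟨η, Generated.root, fun ν hν => (hgood ν hν).1,
    hcl⟩, ?_, fun ν => hK _ (hgood _ ν.2).2, fun ν => hbase _ (hgood _ ν.2).2, ?_, ?_⟩,
    Generated.root, hgood, fun _ => rfl⟩
  · intro ν hν
    obtain ⟨ρ, hρ⟩ := (s ν).pos_nonempty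
    have := of_mem_pos hρ
    rw [hbase _ (hgood ν hν).2] at this
    exact ⟨ρ, Generated.step hν hρ, this.1⟩
  · rintro ⟨ν, hν⟩
    have hb := hbase _ (hgood ν hν).2
    ext ρ
    constructor
    · intro hρ
      have := of_mem_pos hρ
      rw [hb] at this
      exact ⟨Generated.step hν hρ, this⟩
    · rintro ⟨hρ, hνρ, hlen⟩
      change ν.ProperInit ρ at hνρ
      change ρ.len = ν.len + 1 at hlen
      change ρ ∈ (s ν).pos
      cases hρ with
      | root =>
        have := (hgood ν hν).1.1
        omega
      | @step σ _ hσ hρ =>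
        have hσρ := of_mem_pos hρ
        rw [hbase _ (hgood σ hσ).2] at hσρ
        have : σ = ν := (hσρ.1.init.of_len_le hνρ.init (by omega)).eq_of_len_le (by omega)
        exact this ▸ hρ
  · obtain ⟨f, hf, N, hN⟩ := hnor
    exact ⟨f, hf, N, fun ν hν => hN ν (hgood _ ν.2).2 hν⟩

theorem Cond.mem_of_mem_pos (p : C.Cond F) (ν : p.T) {ρ : FinSeq H} (hρ : ρ ∈ (p.t ν).pos) :
    ρ ∈ p.T ∧ ν.1.ProperInit ρ ∧ ρ.len = ν.1.len + 1 := by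
  rw [p.pos_eq] at hρ
  exact hρ

theorem Cond.exists_long (p : C.Cond F) (n : ℕ) : ∃ ν ∈ p.T, n ≤ ν.len := by
  induction n with
  | zero => exact let ⟨r, hr, _⟩ := p.tree; ⟨r, hr, Nat.zero_le _⟩
  | succ n ih =>
    obtain ⟨ν, hν, hn⟩ := ih
    obtain ⟨ρ, hρ, hνρ⟩ := p.no_max ν hν
    exact ⟨ρ, hρ, lt_of_le_of_lt hn hνρ.1⟩

/-- Conditions with a common node above which their norms are bounded by the same function have a
common extension with this node as a root. -/
theorem exists_common_extension {h : ℕ → ℕ → ℕ} (hF_two : ∀ f ∈ F, ∀ n, 2 ≤ f n)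
    (hF_closed : HClosed h F) (hlink : C.HLinked h) (p q : C.Cond F) {η : FinSeq H}
    (hp : η ∈ p.T) (hq : η ∈ q.T) {f : ℕ → ℕ} (hf : f ∈ F)
    (hpf : ∀ ν : p.T, η.len ≤ ν.1.len → (f ν.1.len : ℝ≥0) ≤ (p.t ν).nor)
    (hqf : ∀ ν : q.T, η.len ≤ ν.1.len → (f ν.1.len : ℝ≥0) ≤ (q.t ν).nor) :
    ∃ r : C.Cond F, C.le F p r ∧ C.le F q r ∧ η ∈ r.T ∧ (∀ ν ∈ r.T, η.Init ν) ∧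
      ∀ ν, (h ν.1.len (f ν.1.len) : ℝ≥0) ≤ (r.t ν).nor := by
  have key : ∀ ν : FinSeq H, ∃ s : TreeCreature H D, ∀ (hνp : ν ∈ p.T) (hνq : ν ∈ q.T),
      η.Init ν → s ∈ C.Sig (p.t ⟨ν, hνp⟩) ∧ s ∈ C.Sig (q.t ⟨ν, hνq⟩) ∧
        (h ν.len (f ν.len) : ℝ≥0) ≤ s.nor := by
    intro ν
    by_cases hν : ν ∈ p.T ∧ ν ∈ q.T ∧ η.Init ν
    · obtain ⟨hνp, hνq, hην⟩ := hν
      have hbp := p.base_eq ⟨ν, hνp⟩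
      obtain ⟨s, hs, hn⟩ := hlink (f ν.len) (hF_two f hf _) _ (p.mem ⟨ν, hνp⟩) _ (q.mem ⟨ν, hνq⟩)
        (hbp.trans (q.base_eq ⟨ν, hνq⟩).symm) (hpf ⟨ν, hνp⟩ hην.1) (hqf ⟨ν, hνq⟩ hην.1)
      rw [hbp] at hn
      exact ⟨s, fun _ _ _ => ⟨hs.1, hs.2, hn⟩⟩
    · exact ⟨p.t ⟨η, hp⟩, fun h1 h2 h3 => absurd ⟨h1, h2, h3⟩ hν⟩
  choose s hs using key
  obtain ⟨g, hg, hgh⟩ := hF_closed f hf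
  obtain ⟨N, hN⟩ := eventually_atTop.1 hgh
  obtain ⟨r, hr, hrT, hrs⟩ := exists_cond (C := C) (F := F) s {ν | ν ∈ p.T ∧ ν ∈ q.T ∧ η.Init ν} η
    ⟨hp, hq, FinSeq.Init.refl _⟩
    (fun ν ⟨h1, h2, h3⟩ => C.sig_sub _ (p.mem _) (hs ν h1 h2 h3).1)
    (fun ν ⟨h1, h2, h3⟩ => (C.sig_base _ (p.mem _) _ (hs ν h1 h2 h3).1).trans (p.base_eq _))
    (fun ν ⟨h1, h2, h3⟩ ρ ⟨x, hx⟩ => by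
      obtain ⟨a1, a2, _⟩ := p.mem_of_mem_pos ⟨ν, h1⟩
        ⟨x, C.sig_val _ (p.mem _) _ (hs ν h1 h2 h3).1 hx⟩
      obtain ⟨b1, _⟩ := q.mem_of_mem_pos ⟨ν, h2⟩
        ⟨x, C.sig_val _ (q.mem _) _ (hs ν h1 h2 h3).2.1 hx⟩
      exact ⟨a1, b1, h3.trans a2.init⟩)
    ⟨g, hg, N, fun ν ⟨h1, h2, h3⟩ hν =>
      (Nat.cast_le.2 (hN _ hν)).trans (hs ν h1 h2 h3).2.2⟩
  refine ⟨r, ⟨fun ν hν => (hrT ν hν).2.1, fun ν => ?_⟩,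
    ⟨fun ν hν => (hrT ν hν).2.2.1, fun ν => ?_⟩, hr, fun ν hν => (hrT ν hν).1, fun ν => ?_⟩ <;>
  · obtain ⟨_, h1, h2, h3⟩ := hrT ν.1 ν.2
    rw [hrs]
    obtain ⟨a, b, c⟩ := hs ν.1 h1 h2 h3
    assumption

/-- The conditions with root `η` whose norms are bounded from below by `f` everywhere. -/
def piece (C : TreeCreatingPair H D) (F : Set (ℕ → ℕ)) (i : FinSeq H × F) : Set (C.Cond F) :=
  {p | i.1 ∈ p.T ∧ ∀ ν : p.T, i.1.Init ν.1 ∧ (i.2.1 ν.1.len : ℝ≥0) ≤ (p.t ν).nor}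

theorem exists_mem_piece {h : ℕ → ℕ → ℕ} (hF_two : ∀ f ∈ F, ∀ n, 2 ≤ f n)
    (hF_closed : HClosed h F) (hlink : C.HLinked h) (p : C.Cond F) :
    ∃ i, ∃ q ∈ piece C F i, C.le F p q := by
  obtain ⟨f, hf, N, hN⟩ := p.norm
  obtain ⟨g, hg, hgh⟩ := hF_closed f hf
  obtain ⟨M, hM⟩ := eventually_atTop.1 hgh
  obtain ⟨η, hη, hlen⟩ := p.exists_long (max N M)
  have hpf : ∀ ν : p.T, η.len ≤ ν.1.len → (f ν.1.len : ℝ≥0) ≤ (p.t ν).nor := fun ν hν =>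
    hN ν (((le_max_left _ _).trans hlen).trans hν)
  obtain ⟨r, hpr, -, hr, hroot, hnor⟩ :=
    exists_common_extension hF_two hF_closed hlink p p hη hη hf hpf hpf
  exact ⟨(η, ⟨g, hg⟩), r, ⟨hr, fun ν => ⟨hroot ν.1 ν.2, (Nat.cast_le.2 (hM _
    (((le_max_right _ _).trans hlen).trans (hroot ν.1 ν.2).1))).trans (hnor ν)⟩⟩, hpr⟩

theorem exists_ge {h : ℕ → ℕ → ℕ} (hF_two : ∀ f ∈ F, ∀ n, 2 ≤ f n)
    (hF_closed : HClosed h F) (hlink : C.HLinked h) (p : C.Cond F) : ∃ q, C.le F p q :=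
  let ⟨_, q, _, hq⟩ := exists_mem_piece hF_two hF_closed hlink p
  ⟨q, hq⟩

theorem exists_limit {h : ℕ → ℕ → ℕ} (hF_two : ∀ f ∈ F, ∀ n, 2 ≤ f n)
    (hF_closed : HClosed h F) (hF_directed : GeStarDirected F) (hlink : C.HLinked h)
    (hBCB : C.BCB) (i : FinSeq H × F) (q : ℕ → C.Cond F) (hq : ∀ n, q n ∈ piece C F i) :
    ∃ p, ∀ r, C.le F p r → ∃ᶠ n in atTop, Forcing.Compat (C.le F) r (q n) := by
  classical
  obtain ⟨η, f, hf⟩ := i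
  set U : Ultrafilter ℕ := hyperfilter ℕ
  have key : ∀ ν : FinSeq H, ∃ s : TreeCreature H D, (∀ᶠ n in (U : Filter ℕ), ν ∈ (q n).T) →
      s ∈ C.K ∧ s.base = ν ∧ (∀ ρ ∈ s.pos, ∀ᶠ n in (U : Filter ℕ), ρ ∈ (q n).T) ∧
        (f ν.len : ℝ≥0) ≤ s.nor := by
    intro ν
    let t : ℕ → TreeCreature H D := fun n =>
      if hν : ν ∈ (q n).T then (q n).t ⟨ν, hν⟩ else (q 0).t ⟨η, (hq 0).1⟩
    have ht : ∀ n (hν : ν ∈ (q n).T), t n = (q n).t ⟨ν, hν⟩ := fun n hν => dif_pos hν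
    by_cases hν : ∀ᶠ n in (U : Filter ℕ), ν ∈ (q n).T
    · obtain ⟨n, hn, hlim⟩ := U.exists_subset_limit (V := {n | ν ∈ (q n).T}) hν
        (fun n => {a | ν.snoc a ∈ (t n).pos}) fun φ hφ => hBCB ν (fun k => t (φ k)) fun k => by
          rw [ht _ (hφ k)]
          exact ⟨(q _).mem _, (q _).base_eq _, le_trans (by exact_mod_cast hF_two f hf ν.len)
            ((hq (φ k)).2 ⟨ν, hφ k⟩).2⟩
      refine ⟨t n, fun _ => ?_⟩
      rw [ht n hn] at hlim ⊢
      refine ⟨(q n).mem _, (q n).base_eq _, fun ρ hρ => ?_, ((hq n).2 ⟨ν, hn⟩).2⟩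
      obtain ⟨-, hνρ, hlen⟩ := (q n).mem_of_mem_pos ⟨ν, hn⟩ hρ
      obtain ⟨a, ha⟩ := FinSeq.exists_at hνρ.1
      obtain rfl := hνρ.init.eq_snoc hlen ha
      filter_upwards [hlim a hρ, hν] with m hm hνm
      rw [ht m hνm] at hm
      exact ((q m).mem_of_mem_pos _ hm).1
    · exact ⟨t 0, fun h' => absurd h' hν⟩
  choose s hs using key
  obtain ⟨p, -, hpT, -⟩ := exists_cond (C := C) (F := F) s
    {ν | ∀ᶠ n in (U : Filter ℕ), ν ∈ (q n).T} η (Eventually.of_forall fun n => (hq n).1)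
    (fun ν hν => (hs ν hν).1) (fun ν hν => (hs ν hν).2.1) (fun ν hν => (hs ν hν).2.2.1)
    ⟨f, hf, 0, fun ν hν _ => (hs ν hν).2.2.2⟩
  refine ⟨p, fun r hpr => ?_⟩
  obtain ⟨g, hg, N, hN⟩ := r.norm
  obtain ⟨e, he, hefg⟩ := hF_directed f hf g hg
  obtain ⟨M, hM⟩ := eventually_atTop.1 hefg
  obtain ⟨ρ, hρ, hlen⟩ := r.exists_long (max N M)
  have hev := (hpT ρ (hpr.1 hρ)).2
  have hfreq : ∃ᶠ n in atTop, ρ ∈ (q n).T :=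
    (Eventually.frequently hev).filter_mono (Nat.hyperfilter_le_atTop)
  refine hfreq.mono fun n hn => ?_
  obtain ⟨x, hx, hy, -⟩ := exists_common_extension hF_two hF_closed hlink r (q n) hρ hn he
    (fun ν hν => le_trans (Nat.cast_le.2 ((hM _ (((le_max_right _ _).trans hlen).trans hν)).trans
      (min_le_right _ _))) (hN ν (((le_max_left _ _).trans hlen).trans hν)))
    (fun ν hν => le_trans (Nat.cast_le.2 ((hM _ (((le_max_right _ _).trans hlen).trans hν)).trans
      (min_le_left _ _))) ((hq n).2 ν).2)
  exact ⟨x, hx, hy⟩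

theorem nice [∀ n, Countable (H n)] {h : ℕ → ℕ → ℕ} (hF_two : ∀ f ∈ F, ∀ n, 2 ≤ f n)
    (hF_countable : F.Countable) (hF_closed : HClosed h F) (hF_directed : GeStarDirected F)
    (hlink : C.HLinked h) (hBCB : C.BCB) : Forcing.Nice (C.le F) := by
  have := hF_countable.to_subtype
  refine Forcing.nice_of_linked_limits cond_le_trans (piece C F)
    (exists_mem_piece hF_two hF_closed hlink) ?_
    (exists_limit hF_two hF_closed hF_directed hlink hBCB)
  intro i p hp q hq
  obtain ⟨r, hpr, hqr, -⟩ := exists_common_extension hF_two hF_closed hlink p q hp.1 hq.1 i.2.2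
    (fun ν _ => (hp.2 ν).2) (fun ν _ => (hq.2 ν).2)
  exact ⟨r, hpr, hqr⟩

theorem addsCohenReal {h : ℕ → ℕ → ℕ} (hF_two : ∀ f ∈ F, ∀ n, 2 ≤ f n)
    (hF_closed : HClosed h F) (hlink : C.HLinked h) (hC : C.CohenProducing) :
    Forcing.AddsCohenReal (C.le F) := by
  choose A hA using hC
  refine Forcing.addsCohenReal_of_decides cond_le_trans
    (fun p s => ∀ ν ∈ p.T, ν.Decides A s) ?_ ?_ ?_
  · exact fun p q s hpq hp ν hν => hp ν (hpq.1 hν)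
  · intro p s t hs ht n a b hsa htb
    obtain ⟨ν, hν, -⟩ := p.tree
    exact (hs ν hν).eq_of_getElem? (ht ν hν) hsa htb
  · intro p
    obtain ⟨f, hf, N, hN⟩ := p.norm
    obtain ⟨η, hη, hlen⟩ := p.exists_long N
    obtain ⟨s, hs, hsd⟩ := η.exists_decides A
    refine ⟨s, ?_⟩
    rintro _ ⟨x, rfl⟩
    have hnode : ∃ ν ∈ p.T, N ≤ ν.len ∧ (s ++ x).length = ν.len ∧ ν.Decides A (s ++ x) := by
      induction x using List.reverseRecOn with
      | nil => exact ⟨η, hη, hlen, by simpa using hs, by simpa using hsd⟩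
      | append_singleton x b ih =>
        obtain ⟨ν, hν, hNν, hl, hd⟩ := ih
        have hone : 1 < (p.t ⟨ν, hν⟩).nor :=
          lt_of_lt_of_le (by exact_mod_cast hF_two f hf ν.len) (hN ⟨ν, hν⟩ hNν)
        obtain ⟨y₀, hy₀, y₁, hy₁, ⟨a₁, ha₁, hya₁⟩, a₀, ha₀, hya₀⟩ :=
          hA ν.len _ (p.mem ⟨ν, hν⟩) hone (by rw [p.base_eq])
        have hy : ∃ y ∈ (p.t ⟨ν, hν⟩).pos, ∃ a, y.At ν.len a ∧ (a ∈ A ν.len ↔ b = true) := by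
          cases b
          · exact ⟨y₀, hy₀, a₀, hya₀, by simpa using ha₀⟩
          · exact ⟨y₁, hy₁, a₁, hya₁, by simpa using ha₁⟩
        obtain ⟨y, hy, a, hya, hab⟩ := hy
        obtain ⟨hyT, hνy, hyl⟩ := p.mem_of_mem_pos _ hy
        change ν.ProperInit y at hνy
        change y.len = ν.len + 1 at hyl
        rw [← List.append_assoc]
        exact ⟨y, hyT, by omega, by rw [List.length_append, hl, hyl, List.length_singleton],
          hd.append_singleton hνy.init hl hya hab⟩
    obtain ⟨ν, hν, hNν, -, hd⟩ := hnode
    have hpf : ∀ ρ : p.T, ν.len ≤ ρ.1.len → (f ρ.1.len : ℝ≥0) ≤ (p.t ρ).nor := fun ρ hρ =>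
      hN ρ (hNν.trans hρ)
    obtain ⟨r, hpr, -, -, hroot, -⟩ :=
      exists_common_extension hF_two hF_closed hlink p p hν hν hf hpf hpf
    exact ⟨r, hpr, fun ρ hρ => hd.of_init (hroot ρ hρ)⟩

end TreeCreatingPair

namespace Creature

variable {H : ℕ → Type u} {D : Type v}

/-- The values at `n` of the possibilities of `t`. -/
def valuesAt (t : Creature H D) (n : ℕ) : Set (H n) := {a | ∃ x ∈ t.val, x.2.At n a}

theorem len_of_mem_dom {t : Creature H D} {u : FinSeq H} (hu : u ∈ t.dom) : u.len = t.dn :=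
  let ⟨_, hv⟩ := hu
  (t.val_spec _ hv).1

end Creature

namespace CreatingPair

open Creature

variable {H : ℕ → Type u} {D : Type v} {C : CreatingPair H D} {F : Set (ℕ → ℕ)}

theorem of_mem_sig_singleton {t s : Creature H D} (ht : t ∈ C.K) (hs : s ∈ C.Sig {t}) :
    s ∈ C.K ∧ s.dn = t.dn ∧ s.up = t.up ∧ t.dom = s.dom ∧ s.val ⊆ t.val := by
  have himg : (fun _ : ℕ => t) '' Set.Iic 0 = {t} :=
    Set.Nonempty.image_const ⟨0, Set.mem_Iic.2 le_rfl⟩ t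
  have hch : Chained (fun _ : ℕ => t) 0 := fun i hi => absurd hi (Nat.not_lt_zero i)
  rw [← himg] at hs
  obtain ⟨hdn, hup⟩ := C.sig_ends 0 _ (fun _ _ => ht) hch s hs
  obtain ⟨hdom, hval⟩ := C.sig_nice 0 _ (fun _ _ => ht) hch s hs
  rw [himg] at hs
  refine ⟨C.sig_sub _ (Set.singleton_subset_iff.2 ht) (Set.finite_singleton t) hs, hdn, hup, hdom,
    fun x hx => ?_⟩
  have h1 := hval x hx 0 le_rfl
  obtain ⟨h2, h3, h4⟩ := s.val_spec x hx
  rwa [h4.init.restrict_eq (h2.trans hdn), (FinSeq.Init.refl x.2).restrict_eq (h3.trans hup)] at h1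

namespace PreCond

variable (p : C.PreCond)

theorem dn_eq (hloc : C.Local) (i : ℕ) : (p.t i).dn = p.w.len + i := by
  induction i with
  | zero => exact (len_of_mem_dom p.w_mem).symm
  | succ i ih => rw [← p.chain i, hloc _ (p.mem i), ih, Nat.add_assoc]

theorem up_eq (hloc : C.Local) (i : ℕ) : (p.t i).up = p.w.len + i + 1 := by
  rw [hloc _ (p.mem i), p.dn_eq hloc]

theorem sig_of_apply (hloc : C.Local) {p q : C.PreCond} (hpq : C.Apply p q) (i : ℕ) :
    q.t i ∈ C.Sig {p.t i} := by
  obtain ⟨hw, n, h0, hn, hs⟩ := hpq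
  have hend : ∀ i, (q.t i).dn = (p.t (n i)).dn ∧ (q.t i).up = (p.t (n (i + 1) - 1)).up := by
    intro i
    have hlt := hn (Nat.lt_succ_self i)
    rw [Nat.succ_eq_add_one] at hlt
    have himg : p.t '' Set.Ico (n i) (n (i + 1)) =
        (fun j => p.t (n i + j)) '' Set.Iic (n (i + 1) - 1 - n i) := by
      ext x
      constructor
      · rintro ⟨j, ⟨h1, h2⟩, rfl⟩
        exact ⟨j - n i, Set.mem_Iic.2 (by omega), by simp only; congr 1; omega⟩
      · rintro ⟨j, hj, rfl⟩
        have := Set.mem_Iic.1 hj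
        exact ⟨n i + j, ⟨by omega, by omega⟩, rfl⟩
    have h1 := hs i
    rw [himg] at h1
    have h2 := C.sig_ends _ (fun j => p.t (n i + j)) (fun j _ => p.mem _)
      (fun j _ => p.chain (n i + j)) _ h1
    rw [show n (i + 1) - 1 = n i + (n (i + 1) - 1 - n i) by omega]
    exact h2
  have hni : ∀ i, n i = i := by
    intro i
    have := (hend i).1
    rw [q.dn_eq hloc, p.dn_eq hloc, hw] at this
    omega
  have := hs i
  rw [hni, hni] at this
  have himg : p.t '' Set.Ico i (i + 1) = {p.t i} := by
    rw [Set.Ico_add_one_right_eq_Icc, Set.Icc_self, Set.image_singleton]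
  rwa [himg] at this

theorem init_of_reaches {p q : C.PreCond}
    (hpq : Relation.ReflTransGen (fun a b : C.PreCond => C.Decide a b ∨ C.Apply a b) p q) :
    p.w.Init q.w := by
  induction hpq with
  | refl => exact FinSeq.Init.refl _
  | tail _ hstep ih =>
    rcases hstep with ⟨n, hn, _⟩ | ⟨hw, _⟩
    · exact ih.trans hn.2.1.init
    · rwa [hw]

/-- All the values of the possibilities of `p` belong to the sets `G i`. -/
def ValuesIn (G : ∀ i, Set (H i)) (p : C.PreCond) : Prop :=
  (∀ i a, p.w.At i a → a ∈ G i) ∧ ∀ j i a, (p.t j).dn = i → a ∈ (p.t j).valuesAt i → a ∈ G i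

theorem ValuesIn.of_reaches (hloc : C.Local) {G : ∀ i, Set (H i)} {p q : C.PreCond}
    (hp : p.ValuesIn G)
    (hpq : Relation.ReflTransGen (fun a b : C.PreCond => C.Decide a b ∨ C.Apply a b) p q) :
    q.ValuesIn G := by
  induction hpq with
  | refl => exact hp
  | @tail b c _ hstep ih =>
    rcases hstep with ⟨n, ⟨hlen, hinit, hpos⟩, ht⟩ | happ
    · refine ⟨fun i a ha => ?_, fun j i a hj ha => ?_⟩
      · rcases lt_or_ge i b.w.len with hi | hi
        · exact ih.1 i a (hinit.init.at_of_lt ha hi)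
        · have hlt := ha.lt
          rw [hlen, b.up_eq hloc] at hlt
          refine ih.2 (i - b.w.len) i a (by rw [b.dn_eq hloc]; omega) ⟨_, hpos _ (by omega), ?_⟩
          exact FinSeq.at_restrict.2 ⟨by rw [b.up_eq hloc]; omega, ha⟩
      · rw [ht] at hj ha
        exact ih.2 _ i a hj ha
    · refine ⟨fun i a ha => ih.1 i a (happ.1 ▸ ha), fun j i a hj ha => ?_⟩
      obtain ⟨_, hdn, _, _, hval⟩ := of_mem_sig_singleton (b.mem j) (sig_of_apply hloc happ j)
      obtain ⟨x, hx, hxa⟩ := ha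
      exact ih.2 j i a (hdn ▸ hj) ⟨x, hval hx, hxa⟩

end PreCond

theorem cond_le_refl (p : C.Cond F) : C.le F p p := Relation.ReflTransGen.refl

theorem cond_le_trans (p q r : C.Cond F) (hpq : C.le F p q) (hqr : C.le F q r) : C.le F p r :=
  Relation.ReflTransGen.trans hpq hqr

theorem exists_decide (p : C.Cond F) {y : FinSeq H} (hy : (p.1.w, y) ∈ (p.1.t 0).val) :
    ∃ q : C.Cond F, C.le F p q ∧ q.1.w = y ∧ ∀ i, q.1.t i = p.1.t (i + 1) := by
  obtain ⟨hdn, hup, hwy⟩ := (p.1.t 0).val_spec _ hy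
  change p.1.w.len = _ at hdn
  change y.len = _ at hup
  change p.1.w.ProperInit y at hwy
  have hval : ∀ x : FinSeq H, y.Init x →
      (x.restrict (p.1.t 0).dn, x.restrict (p.1.t 0).up) ∈ (p.1.t 0).val := by
    intro x hx
    rwa [(hwy.init.trans hx).restrict_eq hdn, hx.restrict_eq hup]
  have hypos : y ∈ pos p.1.w p.1.t 0 := ⟨hup, hwy, fun i hi => by
    obtain rfl := Nat.le_zero.1 hi
    exact hval y (FinSeq.Init.refl y)⟩
  let q : C.PreCond :=
    { w := y
      t := fun i => p.1.t (i + 1)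
      mem := fun i => p.1.mem _
      chain := fun i => p.1.chain _
      w_mem := p.1.pos_sub 0 hypos
      pos_sub := fun i x ⟨hx, hyx, hxi⟩ => p.1.pos_sub (i + 1)
        ⟨hx, (hwy.init.trans hyx.init).proper (hwy.1.trans hyx.1), fun j hj => by
          cases j with
          | zero => exact hval x hyx.init
          | succ j => exact hxi j (by omega)⟩ }
  obtain ⟨f, hf, hfp⟩ := p.2
  refine ⟨⟨q, f, hf, (tendsto_add_atTop_nat 1).eventually hfp⟩,
    Relation.ReflTransGen.single (Or.inl ⟨0, hypos, fun i => ?_⟩), rfl, fun _ => rfl⟩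
  change p.1.t (i + 1) = _
  rw [Nat.zero_add, Nat.add_comm]

theorem exists_decide_add (p : C.Cond F) (k : ℕ) :
    ∃ q : C.Cond F, C.le F p q ∧ ∀ i, q.1.t i = p.1.t (i + k) := by
  induction k with
  | zero => exact ⟨p, cond_le_refl p, fun _ => rfl⟩
  | succ k ih =>
    obtain ⟨q, hpq, hq⟩ := ih
    obtain ⟨y, hy⟩ := q.1.w_mem
    obtain ⟨r, hqr, -, hr⟩ := exists_decide q hy
    exact ⟨r, cond_le_trans _ _ _ hpq hqr, fun i => by
      rw [hr, hq, Nat.add_assoc, Nat.add_comm 1 k]⟩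

/-- Every condition has an extension which satisfies the norm condition everywhere. -/
theorem exists_norm_ge (p : C.Cond F) : ∃ f ∈ F, ∃ q : C.Cond F, C.le F p q ∧
    ∀ i, (f (q.1.t i).dn : ℝ≥0) ≤ (q.1.t i).nor := by
  obtain ⟨f, hf, hfp⟩ := p.2
  obtain ⟨M, hM⟩ := eventually_atTop.1 hfp
  obtain ⟨q, hpq, hq⟩ := exists_decide_add p M
  exact ⟨f, hf, q, hpq, fun i => hq i ▸ hM _ (by omega)⟩

theorem compat_of_same_stem {h : ℕ → ℕ → ℕ} (hF_two : ∀ f ∈ F, ∀ n, 2 ≤ f n)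
    (hF_closed : HClosed h F) (hloc : C.Local) (hlink : C.HLinked h) {p q : C.Cond F}
    (hw : p.1.w = q.1.w) {f : ℕ → ℕ} (hf : f ∈ F)
    (hp : ∀ i, (f (p.1.t i).dn : ℝ≥0) ≤ (p.1.t i).nor)
    (hq : ∀ i, (f (q.1.t i).dn : ℝ≥0) ≤ (q.1.t i).nor) : Forcing.Compat (C.le F) p q := by
  have hdn : ∀ i, (p.1.t i).dn = (q.1.t i).dn := fun i => by
    rw [p.1.dn_eq hloc, q.1.dn_eq hloc, hw]
  have hup : ∀ i, (p.1.t i).up = (q.1.t i).up := fun i => by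
    rw [p.1.up_eq hloc, q.1.up_eq hloc, hw]
  have key := fun i => hlink (f (p.1.t i).dn) (hF_two f hf _) _ (p.1.mem i) _ (q.1.mem i) (hp i)
    (hdn i ▸ hq i) (hdn i) (hup i)
  choose s hs hnor using key
  have hsp := fun i => of_mem_sig_singleton (p.1.mem i) (hs i).1
  let r : C.PreCond :=
    { w := p.1.w
      t := s
      mem := fun i => (hsp i).1
      chain := fun i => by rw [(hsp i).2.2.1, (hsp (i + 1)).2.1, p.1.chain]
      w_mem := (hsp 0).2.2.2.1 ▸ p.1.w_mem
      pos_sub := fun i x ⟨hx, hwx, hxi⟩ => by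
        rw [← (hsp (i + 1)).2.2.2.1]
        refine p.1.pos_sub i ⟨hx.trans (hsp i).2.2.1, hwx, fun j hj => (hsp j).2.2.2.2 ?_⟩
        rw [← (hsp j).2.1, ← (hsp j).2.2.1]
        exact hxi j hj }
  have hr : ∃ g ∈ F, ∀ᶠ i in atTop, (g (r.t i).dn : ℝ≥0) ≤ (r.t i).nor := by
    obtain ⟨g, hg, hgh⟩ := hF_closed f hf
    obtain ⟨N, hN⟩ := eventually_atTop.1 hgh
    refine ⟨g, hg, eventually_atTop.2 ⟨N, fun i hi => ?_⟩⟩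
    change (g (s i).dn : ℝ≥0) ≤ (s i).nor
    rw [(hsp i).2.1]
    exact (Nat.cast_le.2 (hN _ (by rw [p.1.dn_eq hloc]; omega))).trans (hnor i)
  have himg : ∀ (t : ℕ → Creature H D) (i : ℕ), t '' Set.Ico i (i + 1) = {t i} := fun t i => by
    rw [Set.Ico_add_one_right_eq_Icc, Set.Icc_self, Set.image_singleton]
  exact ⟨⟨r, hr⟩,
    Relation.ReflTransGen.single (Or.inr ⟨rfl, id, rfl, strictMono_id, fun i =>
      (himg p.1.t i).symm ▸ (hs i).1⟩),
    Relation.ReflTransGen.single (Or.inr ⟨hw, id, rfl, strictMono_id, fun i =>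
      (himg q.1.t i).symm ▸ (hs i).2⟩)⟩

theorem addsCohenReal (hF_two : ∀ f ∈ F, ∀ n, 2 ≤ f n) (hloc : C.Local) (hC : C.CohenProducing) :
    Forcing.AddsCohenReal (C.le F) := by
  choose A hA using hC
  refine Forcing.addsCohenReal_of_decides cond_le_trans (fun p s => p.1.w.Decides A s) ?_ ?_ ?_
  · exact fun p q s hpq hp => hp.of_init (PreCond.init_of_reaches hpq)
  · exact fun p s t hs ht n a b hsa htb => hs.eq_of_getElem? ht hsa htb
  · intro p
    obtain ⟨f, hf, q, hpq, hq⟩ := exists_norm_ge p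
    obtain ⟨s, hs, hsd⟩ := q.1.w.exists_decides A
    refine ⟨s, ?_⟩
    rintro _ ⟨x, rfl⟩
    suffices h : ∃ r : C.Cond F, C.le F q r ∧ (∀ i, 1 < (r.1.t i).nor) ∧
        (s ++ x).length = r.1.w.len ∧ r.1.w.Decides A (s ++ x) by
      obtain ⟨r, hqr, -, -, hr⟩ := h
      exact ⟨r, cond_le_trans _ _ _ hpq hqr, hr⟩
    induction x using List.reverseRecOn with
    | nil =>
      exact ⟨q, cond_le_refl q, fun i => lt_of_lt_of_le (by exact_mod_cast hF_two f hf _) (hq i),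
        by simpa using hs, by simpa using hsd⟩
    | append_singleton x b ih =>
      obtain ⟨r, hqr, hone, hl, hd⟩ := ih
      obtain ⟨y₀, y₁, hy₀, hy₁, ⟨a₁, ha₁, hya₁⟩, a₀, ha₀, hya₀⟩ :=
        hA r.1.w.len _ (r.1.mem 0) (hone 0) r.1.w r.1.w_mem rfl
      have hy : ∃ y, (r.1.w, y) ∈ (r.1.t 0).val ∧
          ∃ a, y.At r.1.w.len a ∧ (a ∈ A r.1.w.len ↔ b = true) := by
        cases b
        · exact ⟨y₀, hy₀, a₀, hya₀, by simpa using ha₀⟩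
        · exact ⟨y₁, hy₁, a₁, hya₁, by simpa using ha₁⟩
      obtain ⟨y, hy, a, hya, hab⟩ := hy
      have hlen : y.len = r.1.w.len + 1 :=
        ((r.1.t 0).val_spec _ hy).2.1.trans (r.1.up_eq hloc 0)
      obtain ⟨r', hrr', hw, ht⟩ := exists_decide r hy
      rw [← List.append_assoc]
      exact ⟨r', cond_le_trans _ _ _ hqr hrr', fun i => ht i ▸ hone _,
        by rw [List.length_append, hl, hw, hlen, List.length_singleton],
        hw ▸ hd.append_singleton ((r.1.t 0).val_spec _ hy).2.2.init hl hya hab⟩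

theorem mem_val_of_mem_valuesAt (hloc : C.Local) (hforg : C.Forgetful) {t : Creature H D}
    (ht : t ∈ C.K) {x y : FinSeq H} (hx : x.len = t.dn) (hy : y.len = t.up) (hxy : x.Init y)
    {i : ℕ} (hi : t.dn = i) {a : H i} (hya : y.At i a) (ha : a ∈ t.valuesAt i) :
    (x, y) ∈ t.val := by
  obtain ⟨⟨u, v⟩, huv, hva⟩ := ha
  have hv : v.len = t.up := (t.val_spec _ huv).2.1
  have hov : x.overwrite v = y := by
    refine FinSeq.eq_of_at (hv.trans hy.symm) fun j b hb => ?_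
    rcases FinSeq.overwrite_at hb with hb | ⟨hj, hb⟩
    · exact hxy.at hb
    · have hlt := hb.lt
      rw [hv, hloc t ht] at hlt
      obtain rfl : j = i := by omega
      rwa [hb.unique hva]
  exact hov ▸ hforg t ht u v x huv hx

theorem mem_dom_of_len (hforg : C.Forgetful) {t : Creature H D} (ht : t ∈ C.K) {x : FinSeq H}
    (hx : x.len = t.dn) : x ∈ t.dom :=
  let ⟨⟨u, v⟩, huv⟩ := t.val_nonempty
  ⟨_, hforg t ht u v x huv hx⟩

theorem exists_decide_to (hloc : C.Local) (hforg : C.Forgetful) (k : ℕ) (p : C.Cond F)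
    (v : FinSeq H) (hv : p.1.w.Init v) (hlen : v.len = p.1.w.len + k)
    (hval : ∀ j < k, ∀ a, v.At (p.1.w.len + j) a → a ∈ (p.1.t j).valuesAt (p.1.w.len + j)) :
    ∃ q : C.Cond F, C.le F p q ∧ q.1.w = v ∧ ∀ i, q.1.t i = p.1.t (i + k) := by
  induction k generalizing p with
  | zero => exact ⟨p, cond_le_refl p, hv.eq_of_len_le hlen.le, fun _ => rfl⟩
  | succ k ih =>
    have hyl : (v.restrict (p.1.w.len + 1)).len = p.1.w.len + 1 := FinSeq.restrict_len (by omega)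
    have hyv := v.restrict_init (p.1.w.len + 1)
    obtain ⟨a, ha⟩ := FinSeq.exists_at (s := v) (n := p.1.w.len) (by omega)
    obtain ⟨q, hpq, hqw, hqt⟩ := exists_decide p (y := v.restrict (p.1.w.len + 1))
      (mem_val_of_mem_valuesAt hloc hforg (p.1.mem 0) (p.1.dn_eq hloc 0).symm
        (hyl.trans (p.1.up_eq hloc 0).symm) (hv.of_len_le hyv (by omega)) (p.1.dn_eq hloc 0)
        (FinSeq.at_restrict.2 ⟨Nat.lt_succ_self _, ha⟩) (hval 0 (Nat.succ_pos k) a ha))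
    have hql : q.1.w.len = p.1.w.len + 1 := by rw [hqw, hyl]
    obtain ⟨r, hqr, hrw, hrt⟩ := ih q (hqw ▸ hyv) (by omega) (by
      intro j hj
      rw [hqt, show q.1.w.len + j = p.1.w.len + (j + 1) by omega]
      exact hval (j + 1) (by omega))
    exact ⟨r, cond_le_trans _ _ _ hpq hqr, hrw, fun i => by rw [hrt, hqt, Nat.add_assoc]⟩

/-- The conditions with stem `w` whose norms are bounded from below by `f` everywhere. -/
def piece (C : CreatingPair H D) (F : Set (ℕ → ℕ)) (i : FinSeq H × F) : Set (C.Cond F) :=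
  {p | p.1.w = i.1 ∧ ∀ j, (i.2.1 (p.1.t j).dn : ℝ≥0) ≤ (p.1.t j).nor}

theorem BCB.exists_subset_limit (hBCB : C.BCB) (U : Ultrafilter ℕ) {i : ℕ}
    (s : ℕ → Creature H D) (hs : ∀ n, s n ∈ C.K ∧ (s n).dn = i ∧ 2 ≤ (s n).nor) :
    ∃ n, ∀ a ∈ (s n).valuesAt i, ∀ᶠ m in (U : Filter ℕ), a ∈ (s m).valuesAt i := by
  obtain ⟨n, -, hn⟩ := U.exists_subset_limit Filter.univ_mem (fun n => (s n).valuesAt i)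
    fun φ _ => by
    obtain ⟨E, n, hn, hE⟩ := hBCB.2.2 i (fun k => s (φ k)) fun k => hs (φ k)
    refine ⟨E, n, hn, fun a ha => (hE a ha).mono fun k hk => ?_⟩
    obtain ⟨⟨⟨l, x⟩, v⟩, hxv⟩ := (s (φ (n k))).val_nonempty
    obtain rfl : l = i := ((s (φ (n k))).val_spec _ hxv).1.trans (hs _).2.1
    exact ⟨_, hk x ⟨v, hxv⟩, FinSeq.snoc_at_len ⟨l, x⟩ a⟩
  exact ⟨n, hn⟩

theorem exists_limit {h : ℕ → ℕ → ℕ} (hF_two : ∀ f ∈ F, ∀ n, 2 ≤ f n)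
    (hF_closed : HClosed h F) (hF_directed : GeStarDirected F) (hlink : C.HLinked h)
    (hBCB : C.BCB) (i : FinSeq H × F) (q : ℕ → C.Cond F) (hq : ∀ n, q n ∈ piece C F i) :
    ∃ p, ∀ r, C.le F p r → ∃ᶠ n in atTop, Forcing.Compat (C.le F) r (q n) := by
  obtain ⟨w, f, hf⟩ := i
  have hloc := hBCB.1
  have hforg := hBCB.2.1
  have hqw : ∀ n, (q n).1.w = w := fun n => (hq n).1
  have hqn : ∀ n j, (f ((q n).1.t j).dn : ℝ≥0) ≤ ((q n).1.t j).nor := fun n => (hq n).2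
  have hqdn : ∀ n j, ((q n).1.t j).dn = w.len + j := fun n j => by
    rw [(q n).1.dn_eq hloc, hqw]
  set U : Ultrafilter ℕ := hyperfilter ℕ
  have key := fun j => hBCB.exists_subset_limit U (i := w.len + j) (fun n => (q n).1.t j) fun n =>
    ⟨(q n).1.mem j, hqdn n j, le_trans (by exact_mod_cast hF_two f hf _) (hqn n j)⟩
  choose N hN using key
  let p : C.PreCond :=
    { w := w
      t := fun j => (q (N j)).1.t j
      mem := fun j => (q (N j)).1.mem j
      chain := fun j => by rw [(q (N j)).1.chain, hqdn, hqdn]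
      w_mem := mem_dom_of_len hforg ((q (N 0)).1.mem 0) (hqdn _ 0).symm
      pos_sub := fun j x hx => mem_dom_of_len hforg ((q (N (j + 1))).1.mem (j + 1)) (by
        rw [hx.1, (q (N j)).1.chain, hqdn, hqdn]) }
  let G : ∀ i, Set (H i) := fun i =>
    {a | ∀ j, w.len + j = i → ∀ᶠ m in (U : Filter ℕ), a ∈ ((q m).1.t j).valuesAt i}
  have hpG : p.ValuesIn G := by
    refine ⟨fun i a ha j hj => ?_, fun j i a hj ha k hk => ?_⟩
    · have hlt : i < w.len := ha.lt
      omega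
    · have hj' : w.len + j = i := (hqdn _ j).symm.trans hj
      obtain rfl : j = k := by omega
      subst hj'
      exact hN j a ha
  refine ⟨⟨p, f, hf, Eventually.of_forall fun j => hqn (N j) j⟩, fun r hpr => ?_⟩
  obtain ⟨g, hg, r₁, hr₁, hnor₁⟩ := exists_norm_ge r
  obtain ⟨e, he, hefg⟩ := hF_directed f hf g hg
  obtain ⟨M, hM⟩ := eventually_atTop.1 hefg
  obtain ⟨r₂, hr₂, ht₂⟩ := exists_decide_add r₁ M
  have hrr₂ := cond_le_trans _ _ _ hr₁ hr₂
  have hMlen : M ≤ r₂.1.w.len := by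
    have := r₂.1.dn_eq hloc 0
    rw [ht₂, r₁.1.dn_eq hloc] at this
    omega
  have hreach := cond_le_trans _ _ _ hpr hrr₂
  have hw₂ : w.Init r₂.1.w := PreCond.init_of_reaches hreach
  obtain ⟨k, hk⟩ := Nat.exists_eq_add_of_le hw₂.1
  have hev : ∀ᶠ m in (U : Filter ℕ), ∀ j ∈ Finset.range k, ∀ a, r₂.1.w.At (w.len + j) a →
      a ∈ ((q m).1.t j).valuesAt (w.len + j) := by
    refine (Filter.eventually_all_finset _).2 fun j hj => ?_
    obtain ⟨a, ha⟩ := FinSeq.exists_at (s := r₂.1.w) (n := w.len + j) (by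
      have := Finset.mem_range.1 hj
      omega)
    refine ((hpG.of_reaches hloc hreach).1 _ a ha j rfl).mono fun m hm b hb => ?_
    rwa [hb.unique ha]
  refine ((Eventually.frequently hev).filter_mono Nat.hyperfilter_le_atTop).mono fun m hm => ?_
  obtain ⟨q', hqq', hq'w, hq't⟩ := exists_decide_to hloc hforg k (q m) r₂.1.w
    ((hqw m).symm ▸ hw₂) (by rw [hqw, hk]) (by
      rw [hqw]
      exact fun j hj => hm j (Finset.mem_range.2 hj))
  have hle : ∀ n ≥ r₂.1.w.len, e n ≤ min (f n) (g n) := fun n hn => hM n (hMlen.trans hn)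
  obtain ⟨x, hx, hy⟩ := compat_of_same_stem hF_two hF_closed hloc hlink hq'w.symm he
    (fun i => le_trans (Nat.cast_le.2 ((hle _ (by rw [r₂.1.dn_eq hloc]; omega)).trans
      (min_le_right _ _))) (by rw [ht₂]; exact hnor₁ _))
    (fun i => le_trans (Nat.cast_le.2 ((hle _ (by rw [q'.1.dn_eq hloc, hq'w]; omega)).trans
      (min_le_left _ _))) (by rw [hq't]; exact hqn m _))
  exact ⟨x, cond_le_trans _ _ _ hrr₂ hx, cond_le_trans _ _ _ hqq' hy⟩

theorem nice [∀ n, Countable (H n)] {h : ℕ → ℕ → ℕ} (hF_two : ∀ f ∈ F, ∀ n, 2 ≤ f n)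
    (hF_countable : F.Countable) (hF_closed : HClosed h F) (hF_directed : GeStarDirected F)
    (hlink : C.HLinked h) (hBCB : C.BCB) : Forcing.Nice (C.le F) := by
  have := hF_countable.to_subtype
  refine Forcing.nice_of_linked_limits cond_le_trans (piece C F) (fun p => ?_) ?_
    (exists_limit hF_two hF_closed hF_directed hlink hBCB)
  · obtain ⟨f, hf, q, hpq, hq⟩ := exists_norm_ge p
    exact ⟨(q.1.w, ⟨f, hf⟩), q, ⟨rfl, hq⟩, hpq⟩
  · exact fun i p hp q hq => compat_of_same_stem hF_two hF_closed hBCB.1 hlink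
      (hp.1.trans hq.1.symm) i.2.2 hp.2 hq.2

end CreatingPair

theorem mainTheorem7 {H : ℕ → Type u} [∀ n, Countable (H n)] [∀ n, Nontrivial (H n)]
    {D : Type v} (h : ℕ → ℕ → ℕ) (hh : Regressive h) (F : Set (ℕ → ℕ))
    (hF_two : ∀ f ∈ F, ∀ n, 2 ≤ f n) (hF_countable : F.Countable) (hF_closed : HClosed h F)
    (hF_directed : GeStarDirected F) :
    (∀ C : CreatingPair H D, C.Local → C.CohenProducing → C.HLinked h →
      Forcing.AddsCohenReal (C.le F)) ∧
    (∀ C : TreeCreatingPair H D, C.CohenProducing → C.HLinked h →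
      Forcing.AddsCohenReal (C.le F)) ∧
    (∀ C : TreeCreatingPair H D, C.HLinked h → C.BCB →
      Forcing.Nice (C.le F) ∧ Forcing.PreservesUnbounded (C.le F)) ∧
    (∀ C : CreatingPair H D, C.HLinked h → C.BCB →
      Forcing.Nice (C.le F) ∧ Forcing.PreservesUnbounded (C.le F)) := by
  refine ⟨fun C hloc hC _ => CreatingPair.addsCohenReal hF_two hloc hC,
    fun C hC hlink => TreeCreatingPair.addsCohenReal hF_two hF_closed hlink hC,
    fun C hlink hBCB => ?_, fun C hlink hBCB => ?_⟩
  · have hnice := TreeCreatingPair.nice hF_two hF_countable hF_closed hF_directed hlink hBCB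
    exact ⟨hnice, hnice.preservesUnbounded TreeCreatingPair.cond_le_trans
      (TreeCreatingPair.exists_ge hF_two hF_closed hlink)⟩
  · have hnice := CreatingPair.nice hF_two hF_countable hF_closed hF_directed hlink hBCB
    exact ⟨hnice, hnice.preservesUnbounded CreatingPair.cond_le_trans fun p =>
      ⟨p, CreatingPair.cond_le_refl p⟩⟩
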